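/- Write $(a)_k=a(a+1)\cdots(a+k-1)$ for the rising factorial. Let $p\ge 1$ be an integer, $\mathbf x=(x_1,\dots,x_{p-1})\in\mathbb C^{p-1}$, $\mathbf y=(y_1,\dots,y_p)\in\mathbb C^p$, and put $$\nu_m=\sum_{k=1}^m (y_k-x_k)\ (1\le m\le p-1),\qquad \psi_m=\sum_{j=1}^m y_j-\sum_{j=1}^{m-1}x_j\ (1\le m\le p),\qquad \nu=\nu(\mathbf x;\mathbf y)=\psi_p .$$ N{\o}rlund's coefficients $g_n^p(\mathbf x;\mathbf y)$, $n\ge 0$, are given by $g_0^1=1$, $g_n^1=0$ for $n\ge1$, and, for $p\ge2$, $$g_n^p(\mathbf x;\mathbf y)=\sum_{m=0}^n\frac{(y_p-x_{p-1})_{n-m}}{(n-m)!}(\nu_{p-1}+m)_{n-m}\;g_m^{p-1}\big((x_1,\dots,x_{p-2});(y_1,\dots,y_{p-1})\big).$$ Equivalently (this equivalence is part of the statement), $(g_n^p(\mathbf x;\mathbf y))_{n\ge0}$ is the unique complex sequence $(g_n)$ such that, for all complex $z$ with sufficiently large real part, the following series converges absolutely to the left-hand side: $$\frac{\prod_{i=1}^{p-1}\Gamma(z+x_i)}{\prod_{j=1}^p\Gamma(z+y_j)}=\sum_{n=0}^\infty\frac{g_n}{\Gamma(z+\nu+n)}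 .$$ Let $\mathcal B_k$ be the classical Bernoulli polynomials, let $\mathcal B_k^{(\sigma)}(z)$ be the Bernoulli--N{\o}rlund polynomials, $\big(\tfrac{t}{e^t-1}\big)^{\sigma}e^{zt}=\sum_{k\ge0}\mathcal B_k^{(\sigma)}(z)\tfrac{t^k}{k!}$, and let $Y_r$ be the complete exponential Bell polynomials, $\exp\big(\sum_{m\ge1}z_m\tfrac{t^m}{m!}\big)=\sum_{r\ge0}Y_r(z_1,\dots,z_r)\tfrac{t^r}{r!}$. For $\alpha\in\mathbb C$ and $m\ge1$ let $$\hat q_m=(m-1)!\,\frac{(-1)^{m+1}}{m+1}\Big(\mathcal B_{m+1}(\alpha)+\sum_{j=1}^{p-1}\mathcal B_{m+1}(x_j)-\sum_{j=1}^{p}\mathcal B_{m+1}(y_j)\Big).$$ Then for every $\alpha\in\mathbb C$ and every integer $n\ge0$ $$g_n^p(\mathbf x;\mathbf y)=\sum_{r=0}^n\frac{(1+\alpha-\nu-n)_{n-r}}{r!\,(n-r)!}\,Y_r(\hat q_1,\dots,\hat q_r)\,\mathcal B^{(n+\nu-\alpha)}_{n-r}(1-\alpha).\qquad(*)$$ In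 particular, the following terminating multiple hypergeometric series, with $\mathbf l=(l_1,\dots,l_{p-2})$ running over $\mathbb N_0^{p-2}$ and $|\mathbf l_m|=l_1+\dots+l_m$, are equal to the right-hand side of $(*)$, whenever none of the denominators occurring in the terms with $|\mathbf l_{p-2}|\le n$ vanishes (the terms with $|\mathbf l_{p-2}|>n$ are zero): (a) for $p\ge3$, $$\frac{(\nu_{p-1})_n(y_p-x_{p-1})_n}{n!}\sum_{\mathbf l}\frac{(-n)_{|\mathbf l_{p-2}|}}{(1-y_p+x_{p-1}-n)_{|\mathbf l_{p-2}|}}\prod_{s=1}^{p-2}\frac{(\nu_s)_{|\mathbf l_s|}(y_{s+1}-x_s)_{l_s}}{(\nu_{s+1})_{|\mathbf l_s|}\,l_s!};$$ (b) for odd $p\ge3$, with the convention $|\mathbf l_{p-1}|=n$, $$\sum_{\mathbf l}\frac{(-n)_{|\mathbf l_{p-2}|}(-1)^{l_2+l_4+\dots+l_{p-3}}}{l_1!\cdots l_{p-2}!\,n!}\prod_{\substack{m=2\\ m\text{ even}}}^{p-1}\frac{(\psi_{m-1}-x_{m-1})_{|\mathbf l_{m-1}|}(\psi_{m-1}-x_m)_{|\mathbf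 l_{m-1}|}(\psi_{m+1}-y_m)_{|\mathbf l_m|}(\psi_{m+1}-y_{m+1})_{|\mathbf l_m|}}{(\psi_{m-1}-x_{m-1})_{|\mathbf l_{m-2}|}(\psi_{m-1}-x_m)_{|\mathbf l_{m-2}|}(\psi_{m+1}-y_m)_{|\mathbf l_{m-1}|}(\psi_{m+1}-y_{m+1})_{|\mathbf l_{m-1}|}};$$ (c) for even $p\ge4$, with the convention $|\mathbf l_{p-1}|=n$, $$\sum_{\mathbf l}\frac{(-n)_{|\mathbf l_{p-2}|}(-1)^{l_1+l_3+\dots+l_{p-3}}}{l_1!\cdots l_{p-2}!\,n!}(\psi_2-y_2)_{l_1}(\psi_2-y_1)_{l_1}\prod_{\substack{m=2\\ m\text{ even}}}^{p-2}\frac{(\psi_m-x_m)_{|\mathbf l_m|}(\psi_m-x_{m+1})_{|\mathbf l_m|}(\psi_{m+2}-y_{m+1})_{|\mathbf l_{m+1}|}(\psi_{m+2}-y_{m+2})_{|\mathbf l_{m+1}|}}{(\psi_m-x_m)_{|\mathbf l_{m-1}|}(\psi_m-x_{m+1})_{|\mathbf l_{m-1}|}(\psi_{m+2}-y_{m+1})_{|\mathbf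 l_m|}(\psi_{m+2}-y_{m+2})_{|\mathbf l_m|}}.$$ -/

import Mathlib

noncomputable section

namespace Norlund

open Finset

/-- The rising factorial `(a)_n = a (a + 1) ⋯ (a + n - 1)`. -/
def poch (a : ℂ) (n : ℕ) : ℂ := (ascPochhammer ℂ n).eval a

/-! Parameter vectors `𝐱 = (x₁, …, x_{p-1})` and `𝐲 = (y₁, …, y_p)` are given by
sequences `x y : ℕ → ℂ` indexed from `1`; only `x 1, …, x (p - 1)` and `y 1, …, y p`
enter the objects belonging to `p`. -/

/-- `ν_m = ∑_{k=1}^m (y_k - x_k)`. -/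
def nu (x y : ℕ → ℂ) (m : ℕ) : ℂ := ∑ k ∈ Icc 1 m, (y k - x k)

/-- `ψ_m = ∑_{j=1}^m y_j - ∑_{j=1}^{m-1} x_j`. In particular `ψ_p` is
the parametric excess `ν(𝐱; 𝐲)` of the two vectors belonging to `p`. -/
def psi (x y : ℕ → ℂ) (m : ℕ) : ℂ := ∑ j ∈ Icc 1 m, y j - ∑ j ∈ Icc 1 (m - 1), x j

/-- Nørlund's coefficients `g_n^p(𝐱; 𝐲)`, `p ≥ 1`, through the recurrence in `p` with
`g_0^1 = 1`, `g_n^1 = 0` for `n ≥ 1`, and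
`g_n^p(𝐱; 𝐲) = ∑_{m=0}^n (y_p - x_{p-1})_{n-m} (ν_{p-1} + m)_{n-m} / (n-m)! ⬝ g_m^{p-1}`.
The value at `p = 0` is meaningless and never used. -/
def coeffG (x y : ℕ → ℂ) : ℕ → ℕ → ℂ
  | 0, _ => 0
  | 1, n => if n = 0 then 1 else 0
  | p + 2, n => ∑ m ∈ range (n + 1),
      poch (y (p + 2) - x (p + 1)) (n - m) / ((n - m).factorial : ℂ)
        * poch (nu x y (p + 1) + m) (n - m) * coeffG x y (p + 1) m

/-- The function `g : ℕ → ℂ` gives the coefficients of the inverse gamma series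
`Γ(z + 𝐱) / Γ(z + 𝐲) = ∑_{n ≥ 0} g_n / Γ(z + ν(𝐱; 𝐲) + n)`,
for all complex `z` of sufficiently large real part. -/
def IsInverseGammaSeries (p : ℕ) (x y : ℕ → ℂ) (g : ℕ → ℂ) : Prop :=
  ∃ M : ℝ, ∀ z : ℂ, M < z.re →
    HasSum (fun n : ℕ => g n / Complex.Gamma (z + psi x y p + n))
      ((∏ i ∈ Icc 1 (p - 1), Complex.Gamma (z + x i)) /
        ∏ j ∈ Icc 1 p, Complex.Gamma (z + y j))

/-- The Bernoulli–Nørlund polynomial `B_k^{(σ)}(z)`, generated by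
`(t / (e^t - 1))^σ e^{zt} = ∑_k B_k^{(σ)}(z) t^k / k!`. Here `(t / (e^t - 1))^σ` is the binomial
series `(1 + u)^{-σ}` at `u = (e^t - 1) / t - 1 = ∑_{k ≥ 1} t^k / (k + 1)!`. -/
def bernoulliNorlund (σ : ℂ) (k : ℕ) (z : ℂ) : ℂ :=
  (k.factorial : ℂ) * PowerSeries.coeff k
    ((PowerSeries.binomialSeries ℂ (-σ)).subst
        (PowerSeries.mk fun k : ℕ => if k = 0 then (0 : ℂ) else 1 / ((k + 1).factorial : ℂ))
      * PowerSeries.rescale z (PowerSeries.exp ℂ))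

/-- The complete exponential Bell polynomial `Y_r(z₁, …, z_r)`, generated by
`exp (∑_{m ≥ 1} z_m t^m / m!) = ∑_r Y_r(z₁, …, z_r) t^r / r!`. -/
def bellY (r : ℕ) (z : ℕ → ℂ) : ℂ :=
  (r.factorial : ℂ) * PowerSeries.coeff r
    ((PowerSeries.exp ℂ).subst
      (PowerSeries.mk fun m : ℕ => if m = 0 then (0 : ℂ) else z m / (m.factorial : ℂ)))

/-- The classical Bernoulli polynomial at a complex point. -/
def bernoulliC (m : ℕ) (z : ℂ) : ℂ := Polynomial.aeval z (Polynomial.bernoulli m)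

/-- `q_m(𝐱; 𝐲; α)`, `m ≥ 1`. -/
def q (p : ℕ) (x y : ℕ → ℂ) (α : ℂ) (m : ℕ) : ℂ :=
  (-1) ^ (m + 1) / ((m : ℂ) + 1) *
    (bernoulliC (m + 1) α + ∑ j ∈ Icc 1 (p - 1), bernoulliC (m + 1) (x j)
      - ∑ j ∈ Icc 1 p, bernoulliC (m + 1) (y j))

/-- `q̂_m = (m - 1)! q_m`, `m ≥ 1`. -/
def qHat (p : ℕ) (x y : ℕ → ℂ) (α : ℂ) (m : ℕ) : ℂ :=
  ((m - 1).factorial : ℂ) * q p x y α m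

/-- The single sum
`∑_{r=0}^n (1 + α - ν - n)_{n-r} / (r! (n-r)!) ⬝ Y_r(q̂₁, …, q̂_r) B_{n-r}^{(n+ν-α)}(1 - α)`,
with `ν = ν(𝐱; 𝐲)`. -/
def bellSum (p : ℕ) (x y : ℕ → ℂ) (α : ℂ) (n : ℕ) : ℂ :=
  ∑ r ∈ range (n + 1),
    poch (1 + α - psi x y p - n) (n - r) / ((r.factorial : ℂ) * ((n - r).factorial : ℂ))
      * bellY r (qHat p x y α)
      * bernoulliNorlund (n + psi x y p - α) (n - r) (1 - α)

/-! Multi-indices `(l₁, …, l_d)` are functions `l : Fin d → ℕ`, with `l i` standing for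
`l_{i+1}`. -/

/-- `|𝐥_m| = l₁ + ⋯ + l_m` for `0 ≤ m ≤ d`. -/
def partialSum {d : ℕ} (l : Fin d → ℕ) (m : ℕ) : ℕ := ∑ i : Fin d, if i.val < m then l i else 0

/-- The summand (with the factor in front of the sum) of the first `(p-2)`-fold
terminating hypergeometric series. -/
def term₁ (p : ℕ) (x y : ℕ → ℂ) (n : ℕ) (l : Fin (p - 2) → ℕ) : ℂ :=
  poch (nu x y (p - 1)) n * poch (y p - x (p - 1)) n / (n.factorial : ℂ)
    * (poch (-n) (partialSum l (p - 2)) /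
        poch (1 - y p + x (p - 1) - n) (partialSum l (p - 2))
      * ∏ i : Fin (p - 2),
          poch (nu x y (i.val + 1)) (partialSum l (i.val + 1))
            * poch (y (i.val + 2) - x (i.val + 1)) (l i)
            / (poch (nu x y (i.val + 2)) (partialSum l (i.val + 1)) * ((l i).factorial : ℂ)))

/-- No denominator of the first series vanishes for `|𝐥_{p-2}| ≤ n`, the range in which the
factor `(-n)_{|𝐥_{p-2}|}` is not zero. -/
def Regular₁ (p : ℕ) (x y : ℕ → ℂ) (n : ℕ) : Prop :=
  poch (1 - y p + x (p - 1) - n) n ≠ 0 ∧ ∀ m ∈ Icc 2 (p - 1), poch (nu x y m) n ≠ 0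

/-- `|𝐥_m|` for `0 ≤ m ≤ p - 1`, where `l_{p-1} = n - l₁ - ⋯ - l_{p-2}`, so that
`|𝐥_{p-1}| = n`. -/
def partialSumTo (p n : ℕ) (l : Fin (p - 2) → ℕ) (m : ℕ) : ℕ :=
  if m = p - 1 then n else partialSum l m

/-- The summand of the second `(p-2)`-fold terminating series, for odd `p ≥ 3`. -/
def termOdd (p : ℕ) (x y : ℕ → ℂ) (n : ℕ) (l : Fin (p - 2) → ℕ) : ℂ :=
  poch (-n) (partialSum l (p - 2)) * (∏ i : Fin (p - 2), if Even (i.val + 1) then (-1) ^ l i else 1)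
      / ((∏ i : Fin (p - 2), ((l i).factorial : ℂ)) * (n.factorial : ℂ))
    * ∏ m ∈ (Icc 2 (p - 1)).filter Even,
        poch (psi x y (m - 1) - x (m - 1)) (partialSumTo p n l (m - 1))
          * poch (psi x y (m - 1) - x m) (partialSumTo p n l (m - 1))
          * poch (psi x y (m + 1) - y m) (partialSumTo p n l m)
          * poch (psi x y (m + 1) - y (m + 1)) (partialSumTo p n l m)
        / (poch (psi x y (m - 1) - x (m - 1)) (partialSumTo p n l (m - 2))
          * poch (psi x y (m - 1) - x m) (partialSumTo p n l (m - 2))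
          * poch (psi x y (m + 1) - y m) (partialSumTo p n l (m - 1))
          * poch (psi x y (m + 1) - y (m + 1)) (partialSumTo p n l (m - 1)))

/-- No denominator of the second series vanishes for `|𝐥_{p-2}| ≤ n` (odd `p`; for `m = 2` the
first two denominators are `(⬝)_0 = 1`). -/
def RegularOdd (p : ℕ) (x y : ℕ → ℂ) (n : ℕ) : Prop :=
  ∀ m ∈ (Icc 2 (p - 1)).filter Even,
    (m ≠ 2 → poch (psi x y (m - 1) - x (m - 1)) n ≠ 0 ∧ poch (psi x y (m - 1) - x m) n ≠ 0) ∧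
    poch (psi x y (m + 1) - y m) n ≠ 0 ∧ poch (psi x y (m + 1) - y (m + 1)) n ≠ 0

/-- The summand of the second `(p-2)`-fold terminating series, for even `p ≥ 4`. -/
def termEven (p : ℕ) (x y : ℕ → ℂ) (n : ℕ) (l : Fin (p - 2) → ℕ) : ℂ :=
  poch (-n) (partialSum l (p - 2)) * (∏ i : Fin (p - 2), if Odd (i.val + 1) then (-1) ^ l i else 1)
      / ((∏ i : Fin (p - 2), ((l i).factorial : ℂ)) * (n.factorial : ℂ))
    * (poch (psi x y 2 - y 2) (partialSum l 1) * poch (psi x y 2 - y 1) (partialSum l 1))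
    * ∏ m ∈ (Icc 2 (p - 2)).filter Even,
        poch (psi x y m - x m) (partialSumTo p n l m)
          * poch (psi x y m - x (m + 1)) (partialSumTo p n l m)
          * poch (psi x y (m + 2) - y (m + 1)) (partialSumTo p n l (m + 1))
          * poch (psi x y (m + 2) - y (m + 2)) (partialSumTo p n l (m + 1))
        / (poch (psi x y m - x m) (partialSumTo p n l (m - 1))
          * poch (psi x y m - x (m + 1)) (partialSumTo p n l (m - 1))
          * poch (psi x y (m + 2) - y (m + 1)) (partialSumTo p n l m)
          * poch (psi x y (m + 2) - y (m + 2)) (partialSumTo p n l m))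

/-- No denominator of the second series vanishes for `|𝐥_{p-2}| ≤ n` (even `p`). -/
def RegularEven (p : ℕ) (x y : ℕ → ℂ) (n : ℕ) : Prop :=
  ∀ m ∈ (Icc 2 (p - 2)).filter Even,
    poch (psi x y m - x m) n ≠ 0 ∧ poch (psi x y m - x (m + 1)) n ≠ 0 ∧
    poch (psi x y (m + 2) - y (m + 1)) n ≠ 0 ∧ poch (psi x y (m + 2) - y (m + 2)) n ≠ 0

end Norlund

end

noncomputable section

namespace Norlund

open Finset

/-! Every assertion is a statement about the sequence `coeffG` defined by the recurrence in `p`.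

Inverse gamma series. Passing from `p` to `p + 1` multiplies the gamma ratio by `Γ(z + x_p) / Γ(z +
y_{p+1})`. Gauss' theorem (`hasSum_gauss`) expands each term of the old series times this factor,
and the resulting double series converges absolutely, so it may be summed along antidiagonals; these
antidiagonal sums are exactly the recurrence. Uniqueness follows by multiplying by a gamma function
and letting `z → +∞`, which isolates the first nonzero coefficient (`eq_zero_of_hasSum_zero`).

The single sum. No analysis is needed: `Γ(z + b)` is replaced by its formal Stirling series
`gammaSer b` in `X = 1 / z`. The difference equation of the Bernoulli polynomials yields `gammaSer
(b + 1) = (1 + b X) gammaSer b`, and all coefficients are polynomials in `b`. An identity with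
polynomial coefficients need only be checked at the non-positive integers, where the series
terminate: the formal Gauss theorem (`gammaSer_gauss`) becomes Chu–Vandermonde in the ring of power
series, and the expansion of `z^{-s} / Γ(z + α)` (`invGammaSer_eq_triSum`) becomes Newton
interpolation of `z^N`. The formal gamma ratio has coefficients `Y_r(q̂) / r!`; expanding its
quotient by `Γ(z + α)` in both ways along `X^k invGammaSer (ν + k)` and comparing coefficients gives
the formula.

Multiple series. Iterating the recurrence gives a sum over chains `0 ≤ j₁ ≤ j₂ ≤ ⋯`, the partial
sums of `𝐥` (`hasSum_chain`). The first series uses the recurrence as it stands; the second merges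
its steps two by two with a `₃F₂` transformation (`threeFTwo_transform`). -/

/-- The homogeneous rising factorial `u (u + w) ⋯ (u + (n - 1) w)`. -/
def rise {R : Type*} [CommRing R] (w u : R) (n : ℕ) : R := ∏ i ∈ range n, (u + i * w)

/-! ### Rising factorials, Chu–Vandermonde and a `₃F₂` transformation -/

section Rise

variable {R : Type*} [CommRing R]

@[simp] lemma rise_zero (w u : R) : rise w u 0 = 1 := by simp [rise]

lemma rise_succ (w u : R) (n : ℕ) : rise w u (n + 1) = rise w u n * (u + n * w) := by
  simp [rise, prod_range_succ]

lemma rise_add (w u : R) (m n : ℕ) : rise w u (m + n) = rise w u m * rise w (u + m * w) n := by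
  simp only [rise, prod_range_add]
  congr 1
  refine prod_congr rfl fun i _ => ?_
  push_cast
  ring

/-- Reflection of the rising factorial. -/
lemma rise_reflect (w u : R) (n : ℕ) :
    rise w (w - u - n * w) n = (-1) ^ n * rise w u n := by
  have h : ((-1 : R)) ^ n = ∏ _i ∈ range n, (-1 : R) := by simp
  rw [rise, rise, ← prod_range_reflect, h, ← prod_mul_distrib]
  refine prod_congr rfl fun i hi => ?_
  have : i + 1 ≤ n := mem_range.mp hi
  rw [show n - 1 - i = n - (i + 1) by omega, Nat.cast_sub this]
  push_cast
  ring

/-- The Chu–Vandermonde identity. -/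
lemma rise_vandermonde (w u v : R) (n : ℕ) :
    rise w (u + v) n = ∑ ij ∈ antidiagonal n,
      (n.choose ij.1 : R) * (rise w u ij.1 * rise w v ij.2) := by
  induction n with
  | zero => simp
  | succ n ih =>
    rw [rise_succ, ih, sum_mul,
      Finset.sum_antidiagonal_choose_succ_mul (fun i j => rise w u i * rise w v j),
      ← sum_add_distrib]
    refine sum_congr rfl fun ij hij => ?_
    obtain ⟨i, j⟩ := ij
    rw [HasAntidiagonal.mem_antidiagonal] at hij
    have hij' : i + j = n := hij
    have h : n.choose j = n.choose i := Nat.choose_symm_of_eq_add (by omega)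
    simp only [rise_succ, h]
    rw [← hij']
    push_cast
    ring

/-- The alternating form of the Chu–Vandermonde identity. -/
lemma rise_sub (w d b : R) (n : ℕ) :
    rise w (d - b) n = ∑ ij ∈ antidiagonal n,
      (n.choose ij.1 : R) * ((-1) ^ ij.1 * (rise w b ij.1 * rise w (d + ij.1 * w) ij.2)) := by
  have h := rise_reflect w (d - b) n
  -- Reflection turns the difference `d - b` into a sum, to which Chu–Vandermonde applies; a second
  -- reflection restores the factor with `d`.
  have e : w - (d - b) - n * w = b + (w - d - n * w) := by ring
  have sq : ∀ k : ℕ, ((-1 : R) ^ k) * (-1) ^ k = 1 := fun k => by rw [← mul_pow]; simp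
  rw [e, rise_vandermonde] at h
  have h2 : rise w (d - b) n = (-1) ^ n * ((-1) ^ n * rise w (d - b) n) := by
    rw [← mul_assoc, sq, one_mul]
  rw [h2, ← h, mul_sum]
  refine sum_congr rfl fun ij hij => ?_
  obtain ⟨i, j⟩ := ij
  have hij' : i + j = n := by simpa using hij
  have r := rise_reflect w (d + i * w) j
  have e2 : w - (d + i * w) - j * w = w - d - n * w := by
    rw [← hij']; push_cast; ring
  rw [e2] at r
  simp only [r]
  rw [← hij', pow_add]
  linear_combination ((i + j).choose i : R) * (-1) ^ i * rise w b i * rise w (d + i * w) j * sq j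

end Rise

lemma poch_eq_rise (a : ℂ) (n : ℕ) : poch a n = rise 1 a n := by
  induction n with
  | zero => simp [poch]
  | succ n ih =>
    rw [rise_succ, ← ih, poch, poch, ascPochhammer_succ_eval]
    ring

@[simp] lemma poch_zero (a : ℂ) : poch a 0 = 1 := by simp [poch]

lemma poch_succ (a : ℂ) (n : ℕ) : poch a (n + 1) = poch a n * (a + n) := by
  simp [poch, ascPochhammer_succ_eval]

lemma poch_add (a : ℂ) (m n : ℕ) : poch a (m + n) = poch a m * poch (a + m) n := by
  simp [poch_eq_rise, rise_add]

lemma poch_reflect (a : ℂ) (n : ℕ) : poch (1 - a - n) n = (-1) ^ n * poch a n := by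
  simpa [poch_eq_rise] using rise_reflect 1 a n

lemma poch_ne_zero_of_le {a : ℂ} {m n : ℕ} (h : m ≤ n) (hn : poch a n ≠ 0) : poch a m ≠ 0 := by
  obtain ⟨k, rfl⟩ := Nat.exists_eq_add_of_le h
  rw [poch_add] at hn
  exact left_ne_zero_of_mul hn

lemma poch_shift {a : ℂ} {m n : ℕ} (h : m ≤ n) (hm : poch a m ≠ 0) :
    poch (a + m) (n - m) = poch a n / poch a m := by
  obtain ⟨k, rfl⟩ := Nat.exists_eq_add_of_le h
  rw [poch_add, Nat.add_sub_cancel_left, mul_div_cancel_left₀ _ hm]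

lemma poch_neg_of_lt {n k : ℕ} (h : n < k) : poch (-(n : ℂ)) k = 0 :=
  ascPochhammer_eval_neg_coe_nat_of_lt h

lemma poch_neg_mul_factorial {n k : ℕ} (h : k ≤ n) :
    poch (-(n : ℂ)) k * ((n - k).factorial : ℂ) = (-1) ^ k * (n.factorial : ℂ) := by
  induction k with
  | zero => simp
  | succ k ih =>
    have ih := ih (by omega)
    have e : n - k = (n - (k + 1)) + 1 := by omega
    rw [e, Nat.factorial_succ, ← e] at ih
    rw [poch_succ, pow_succ]
    have hc : ((n - k : ℕ) : ℂ) = n - k := by rw [Nat.cast_sub (by omega)]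
    push_cast [hc] at ih
    linear_combination -ih

lemma poch_neg_div_factorial {n k : ℕ} (h : k ≤ n) :
    poch (-(n : ℂ)) k / (n.factorial : ℂ) = (-1) ^ k / ((n - k).factorial : ℂ) := by
  rw [div_eq_div_iff (by exact_mod_cast n.factorial_ne_zero)
    (by exact_mod_cast (n - k).factorial_ne_zero), poch_neg_mul_factorial h]

lemma factorial_cast_ne_zero (n : ℕ) : (n.factorial : ℂ) ≠ 0 := by
  exact_mod_cast n.factorial_ne_zero

lemma choose_div_factorial {n i j : ℕ} (h : i + j = n) :
    (n.choose i : ℂ) = n.factorial / (i.factorial * j.factorial) := by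
  subst h
  rw [eq_div_iff (mul_ne_zero (factorial_cast_ne_zero i) (factorial_cast_ne_zero j))]
  have := Nat.add_choose_mul_factorial_mul_factorial i j
  rw [mul_assoc, ← Nat.choose_symm_add] at this
  exact_mod_cast this

/-- Chu–Vandermonde in the normalization by factorials. -/
lemma poch_add_div_factorial (a b : ℂ) (n : ℕ) :
    poch (a + b) n / (n.factorial : ℂ) = ∑ ij ∈ antidiagonal n,
      poch a ij.1 / (ij.1.factorial : ℂ) * (poch b ij.2 / (ij.2.factorial : ℂ)) := by
  simp only [poch_eq_rise, rise_vandermonde, sum_div]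
  refine sum_congr rfl fun ij hij => ?_
  rw [choose_div_factorial (HasAntidiagonal.mem_antidiagonal.mp hij)]
  have := factorial_cast_ne_zero n
  field_simp

lemma poch_sub_div_factorial (d b : ℂ) (n : ℕ) :
    poch (d - b) n / (n.factorial : ℂ) = ∑ ij ∈ antidiagonal n,
      (-1) ^ ij.1 * poch b ij.1 / (ij.1.factorial : ℂ)
        * (poch (d + ij.1) ij.2 / (ij.2.factorial : ℂ)) := by
  simp only [poch_eq_rise, rise_sub, sum_div]
  refine sum_congr rfl fun ij hij => ?_
  rw [choose_div_factorial (HasAntidiagonal.mem_antidiagonal.mp hij)]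
  have := factorial_cast_ne_zero n
  field_simp

/-- Associativity of summation over antidiagonals. -/
lemma sum_antidiagonal_assoc {M : Type*} [AddCommMonoid M] (n : ℕ) (f : ℕ → ℕ → ℕ → M) :
    ∑ x ∈ antidiagonal n, ∑ u ∈ antidiagonal x.1, f u.1 u.2 x.2
      = ∑ x ∈ antidiagonal n, ∑ u ∈ antidiagonal x.2, f x.1 u.1 u.2 := by
  rw [sum_sigma', sum_sigma']
  refine sum_bij' (fun a _ => ⟨(a.2.1, a.2.2 + a.1.2), (a.2.2, a.1.2)⟩)
    (fun a _ => ⟨(a.1.1 + a.2.1, a.2.2), (a.1.1, a.2.1)⟩) ?_ ?_ ?_ ?_ ?_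
  all_goals
    rintro ⟨⟨i, j⟩, ⟨k, l⟩⟩ h
    simp only [mem_sigma, HasAntidiagonal.mem_antidiagonal] at h
    obtain ⟨rfl, rfl⟩ := h
    simp [add_assoc]

/-- A two-term transformation of terminating `₃F₂` series at unit argument, in a form free of
denominators depending on the parameters. -/
lemma threeFTwo_transform (A B C D : ℂ) (N : ℕ) :
    ∑ ij ∈ antidiagonal N, poch (D - B) ij.1 / (ij.1.factorial : ℂ) * poch A ij.1
        * (poch (C - A) ij.2 / (ij.2.factorial : ℂ) * poch (D + ij.1) ij.2)
      = ∑ lk ∈ antidiagonal N, (-1) ^ lk.1 / ((lk.1.factorial : ℂ) * (lk.2.factorial : ℂ))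
        * (poch A lk.1 * poch B lk.1 * poch (C + lk.1) lk.2 * poch (D + lk.1) lk.2) := by
  -- Expanding `(D - B)_i` gives a triple sum. Once the index of `(B)` is outermost, the two factors
  -- with `D` combine into one depending only on the total of the other two indices, and the inner
  -- sum is Chu–Vandermonde for `(A + l) + (C - A)`.
  simp only [poch_sub_div_factorial D B, sum_mul]
  have key : ∀ x ∈ antidiagonal N, ∀ u ∈ antidiagonal x.1,
      (-1) ^ u.1 * poch B u.1 / (u.1.factorial : ℂ)
        * (poch (D + u.1) u.2 / (u.2.factorial : ℂ)) * poch A x.1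
        * (poch (C - A) x.2 / (x.2.factorial : ℂ) * poch (D + x.1) x.2)
      = (-1) ^ u.1 * poch B u.1 / (u.1.factorial : ℂ) * poch A u.1
        * (poch (D + u.1) (u.2 + x.2)
        * (poch (A + u.1) u.2 / (u.2.factorial : ℂ) *
          (poch (C - A) x.2 / (x.2.factorial : ℂ)))) := by
    rintro ⟨i, j⟩ - ⟨k, l⟩ hu
    obtain rfl : k + l = i := by simpa using hu
    simp only [poch_add, Nat.cast_add, add_assoc]
    ring
  rw [sum_congr rfl fun x hx => sum_congr rfl (key x hx),
    sum_antidiagonal_assoc N fun a b c =>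
      (-1) ^ a * poch B a / (a.factorial : ℂ) * poch A a
        * (poch (D + a) (b + c) * (poch (A + a) b / (b.factorial : ℂ) *
          (poch (C - A) c / (c.factorial : ℂ))))]
  refine sum_congr rfl fun x _ => ?_
  have e : C + x.1 = A + x.1 + (C - A) := by ring
  have h := poch_add_div_factorial (A + x.1) (C - A) x.2
  rw [← e] at h
  rw [← mul_sum]
  have h3 : ∑ u ∈ antidiagonal x.2, poch (D + x.1) (u.1 + u.2) *
      (poch (A + x.1) u.1 / (u.1.factorial : ℂ) * (poch (C - A) u.2 / (u.2.factorial : ℂ)))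
      = poch (D + x.1) x.2 * (poch (C + x.1) x.2 / (x.2.factorial : ℂ)) := by
    rw [h, mul_sum]
    refine sum_congr rfl fun u hu => ?_
    rw [mem_antidiagonal.mp hu]
  rw [h3]
  have := factorial_cast_ne_zero x.1
  have := factorial_cast_ne_zero x.2
  field_simp

/-! ### Multiple series as sums over chains of partial sums -/

section Chains

lemma partialSum_zero {d : ℕ} (l : Fin d → ℕ) : partialSum l 0 = 0 := by simp [partialSum]

lemma partialSum_succ {d : ℕ} (l : Fin d → ℕ) (i : Fin d) :
    partialSum l (i.val + 1) = partialSum l i.val + l i := by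
  have h : ∀ j : Fin d, (if j.val < i.val + 1 then l j else 0)
      = (if j.val < i.val then l j else 0) + if j = i then l j else 0 := by
    intro j
    rcases lt_trichotomy j.val i.val with h | h | h
    · simp [h, Nat.lt_succ_of_lt h, Fin.ne_of_lt (Fin.lt_def.mpr h)]
    · simp [Fin.ext h]
    · have h1 : ¬ j.val < i.val + 1 := by omega
      have h2 : ¬ j.val < i.val := by omega
      simp [h1, h2, Fin.ne_of_gt (Fin.lt_def.mpr h)]
  simp only [partialSum, h, sum_add_distrib, sum_ite_eq', mem_univ, if_true]

lemma le_partialSum {d : ℕ} (l : Fin d → ℕ) (i : Fin d) : l i ≤ partialSum l d := by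
  have h : partialSum l d = ∑ j, l j := by simp [partialSum]
  rw [h]
  exact single_le_sum (fun _ _ => Nat.zero_le _) (mem_univ i)

lemma partialSum_snoc {d : ℕ} (l : Fin d → ℕ) (k : ℕ) {m : ℕ} (hm : m ≤ d) :
    partialSum (Fin.snoc l k : Fin (d + 1) → ℕ) m = partialSum l m := by
  simp [partialSum, Fin.sum_univ_castSucc, not_lt.mpr hm]

lemma partialSum_snoc_last {d : ℕ} (l : Fin d → ℕ) (k : ℕ) :
    partialSum (Fin.snoc l k : Fin (d + 1) → ℕ) (d + 1) = partialSum l d + k := by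
  simp [partialSum, Fin.sum_univ_castSucc]

/-- Total weight of the chains `0 = j₀ ≤ j₁ ≤ ⋯ ≤ j_d = m`, the step from `j_i` to `j_{i+1}`
having weight `W i j_i j_{i+1}`. -/
def chainSum (W : ℕ → ℕ → ℕ → ℂ) : ℕ → ℕ → ℂ
  | 0, m => if m = 0 then 1 else 0
  | d + 1, m => ∑ j ∈ range (m + 1), chainSum W d j * W d j m

lemma summable_of_partialSum_le {d n : ℕ} {f : (Fin d → ℕ) → ℂ}
    (hf : ∀ l, n < partialSum l d → f l = 0) : Summable f := by
  refine summable_of_hasFiniteSupport ((Set.finite_Icc (0 : Fin d → ℕ) fun _ => n).subset ?_)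
  intro l hl
  refine ⟨fun i => Nat.zero_le _, fun i => (le_partialSum l i).trans ?_⟩
  by_contra h
  exact hl (hf l (not_le.mp h))

/-- A multiple series over `ℕ^d` whose terms are products of weights depending on consecutive
partial sums of the indices is a sum over chains. -/
lemma hasSum_chain (W : ℕ → ℕ → ℕ → ℂ) (n d : ℕ) (h : ℕ → ℂ) (hh : ∀ m, n < m → h m = 0) :
    HasSum (fun l : Fin d → ℕ =>
        (∏ i : Fin d, W i.val (partialSum l i.val) (partialSum l (i.val + 1)))
          * h (partialSum l d))
      (∑ m ∈ range (n + 1), chainSum W d m * h m) := by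
  induction d generalizing h with
  | zero =>
    have e : ∑ m ∈ range (n + 1), chainSum W 0 m * h m = h 0 := by
      simp [chainSum]
    rw [e]
    simp [partialSum]
  | succ d ih =>
    -- The last index is summed first: `h' j` absorbs the final step starting at `j`, and the
    -- induction hypothesis applies to the remaining indices with `h'` as end weight.
    set h' : ℕ → ℂ := fun j => ∑ m ∈ Ico j (n + 1), W d j m * h m with hh'
    have h0 : ∀ m, n < m → h' m = 0 := fun m hm => by
      rw [hh']; simp [Ico_eq_empty_of_le (Nat.succ_le_of_lt hm)]
    have ih' := ih h' h0
    set F : (Fin (d + 1) → ℕ) → ℂ := fun l =>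
      (∏ i : Fin (d + 1), W i.val (partialSum l i.val) (partialSum l (i.val + 1)))
          * h (partialSum l (d + 1)) with hF
    have hsum : Summable F := summable_of_partialSum_le (n := n) fun l hl => by
      simp [hF, hh _ hl]
    let e : (Fin d → ℕ) × ℕ ≃ (Fin (d + 1) → ℕ) :=
      (Equiv.prodComm _ _).trans (Fin.snocEquiv fun _ : Fin (d + 1) => ℕ)
    have he : ∀ l k, e (l, k) = (Fin.snoc l k : Fin (d + 1) → ℕ) := fun l k => rfl
    have hsum' : HasSum (F ∘ e) (∑' l, F l) := (e.hasSum_iff).mpr hsum.hasSum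
    have hfib : ∀ l : Fin d → ℕ, HasSum (fun k => (F ∘ e) (l, k))
        ((∏ i : Fin d, W i.val (partialSum l i.val) (partialSum l (i.val + 1)))
          * h' (partialSum l d)) := by
      intro l
      have hFe : ∀ k, (F ∘ e) (l, k) =
          (∏ i : Fin d, W i.val (partialSum l i.val) (partialSum l (i.val + 1)))
          * (W d (partialSum l d) (partialSum l d + k) * h (partialSum l d + k)) := by
        intro k
        simp only [Function.comp, he, hF, Fin.prod_univ_castSucc, Fin.val_castSucc, Fin.val_last,
          partialSum_snoc_last, partialSum_snoc l k le_rfl]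
        rw [mul_assoc]
        congr 1
        refine prod_congr rfl fun i _ => ?_
        rw [partialSum_snoc l k i.isLt.le, partialSum_snoc l k i.isLt]
      simp only [hFe]
      refine HasSum.mul_left _ ?_
      have : h' (partialSum l d) = ∑ k ∈ range (n + 1 - partialSum l d),
          W d (partialSum l d) (partialSum l d + k) * h (partialSum l d + k) := by
        rw [hh']; simp only [sum_Ico_eq_sum_range]
      rw [this]
      refine hasSum_sum_of_ne_finset_zero fun k hk => ?_
      rw [hh _ (by simp at hk; omega), mul_zero]
    have := (HasSum.prod_fiberwise hsum' hfib).unique ih'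
    have hv : ∑ m ∈ range (n + 1), chainSum W (d + 1) m * h m
        = ∑ m ∈ range (n + 1), chainSum W d m * h' m := by
      simp only [chainSum, hh', sum_mul, mul_sum]
      rw [sum_comm' (t' := range (n + 1)) (s' := fun j => Ico j (n + 1))]
      · refine sum_congr rfl fun j _ => sum_congr rfl fun m _ => by ring
      · intro a b
        simp only [mem_range, mem_Ico]
        omega
    rw [hv, ← this]
    exact hsum.hasSum

end Chains

/-! ### The first multiple series -/

lemma coeffG_succ (x y : ℕ → ℂ) (d n : ℕ) :
    coeffG x y (d + 2) n = ∑ m ∈ range (n + 1),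
      poch (y (d + 2) - x (d + 1)) (n - m) / ((n - m).factorial : ℂ)
        * poch (nu x y (d + 1) + m) (n - m) * coeffG x y (d + 1) m := rfl

/-- The weights of the steps in the first multiple series. -/
def stepWeight (x y : ℕ → ℂ) (i j m : ℕ) : ℂ :=
  poch (nu x y (i + 1)) m * poch (y (i + 2) - x (i + 1)) (m - j)
    / (poch (nu x y (i + 2)) m * ((m - j).factorial : ℂ))

/-- In the recurrence `(ν + j)_{m-j} = (ν)_m / (ν)_j`. The weights charge the denominator `(ν)_j` to
the step arriving at `j`, one step early, so a chain sum falls short of the coefficient by the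
factor `(ν_{d+1})_m`. -/
lemma chainSum_stepWeight (x y : ℕ → ℂ) (n d : ℕ)
    (hreg : ∀ k ∈ Icc 2 (d + 1), poch (nu x y k) n ≠ 0) (m : ℕ) (hm : m ≤ n) :
    chainSum (stepWeight x y) d m * poch (nu x y (d + 1)) m = coeffG x y (d + 1) m := by
  induction d generalizing m with
  | zero =>
    rcases eq_or_ne m 0 with rfl | h
    · simp [chainSum, coeffG]
    · simp [chainSum, coeffG, h]
  | succ d ih =>
    have hne : poch (nu x y (d + 2)) m ≠ 0 :=
      poch_ne_zero_of_le hm (hreg _ (by simp))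
    rw [coeffG_succ, chainSum, sum_mul]
    refine sum_congr rfl fun j hj => ?_
    have hj' : j ≤ m := Nat.lt_succ_iff.mp (mem_range.mp hj)
    rw [← ih (fun k hk => hreg k (by simp only [mem_Icc] at hk ⊢; omega)) j (hj'.trans hm)]
    have e : poch (nu x y (d + 1)) m
        = poch (nu x y (d + 1)) j * poch (nu x y (d + 1) + j) (m - j) := by
      rw [← poch_add, Nat.add_sub_cancel' hj']
    have hf := factorial_cast_ne_zero (m - j)
    rw [stepWeight, e]
    field_simp

/-- Reflection expresses the last step of the recurrence, of length `n - m`, through `m` itself;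
this is the origin of `(-n)_m / (1 - a - n)_m` in the first series. -/
lemma poch_sub_div_factorial_sub {a : ℂ} {m n : ℕ} (hm : m ≤ n)
    (h : poch (1 - a - n) m ≠ 0) :
    poch a (n - m) / ((n - m).factorial : ℂ)
      = poch a n / (n.factorial : ℂ) * (poch (-n) m / poch (1 - a - n) m) := by
  have e1 : poch a n = poch a (n - m) * poch (a + (n - m : ℕ)) m := by
    rw [← poch_add, Nat.sub_add_cancel hm]
  have e2 := poch_reflect (a + (n - m : ℕ)) m
  have e3 : 1 - (a + ((n - m : ℕ) : ℂ)) - m = 1 - a - n := by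
    rw [Nat.cast_sub hm]; ring
  rw [e3] at e2
  have e4 := poch_neg_div_factorial hm
  have hs : ((-1 : ℂ) ^ m) * (-1) ^ m = 1 := by rw [← mul_pow]; simp
  have : poch a n / (n.factorial : ℂ) * (poch (-n) m / poch (1 - a - n) m)
    = poch a n * (poch (-n) m / (n.factorial : ℂ)) / poch (1 - a - n) m := by ring
  rw [this, e4, eq_div_iff h, e1, e2]
  ring

/-- The first multiple hypergeometric series sums to Nørlund's coefficient. -/
lemma hasSum_term₁ (p : ℕ) (hp : 3 ≤ p) (x y : ℕ → ℂ) (n : ℕ) (hreg : Regular₁ p x y n) :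
    HasSum (term₁ p x y n) (coeffG x y p n) := by
  obtain ⟨d, rfl⟩ : ∃ d, p = d + 2 := ⟨p - 2, by omega⟩
  obtain ⟨hr1, hr2⟩ := hreg
  simp only [show d + 2 - 1 = d + 1 by omega] at hr1 hr2
  have hr3 : 1 - y (d + 2) + x (d + 1) - (n : ℂ) = 1 - (y (d + 2) - x (d + 1)) - n := by ring
  set h : ℕ → ℂ := fun m => poch (nu x y (d + 1)) n * poch (y (d + 2) - x (d + 1)) n
    / (n.factorial : ℂ) * (poch (-n) m / poch (1 - y (d + 2) + x (d + 1) - n) m) with hh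
  have key := hasSum_chain (stepWeight x y) n d h fun m hm => by
    simp [hh, poch_neg_of_lt hm]
  have e1 : ∑ m ∈ range (n + 1), chainSum (stepWeight x y) d m * h m
      = coeffG x y (d + 2) n := by
    rw [coeffG_succ]
    refine sum_congr rfl fun m hm => ?_
    have hm' : m ≤ n := Nat.lt_succ_iff.mp (mem_range.mp hm)
    have hne := poch_ne_zero_of_le hm' hr1
    rw [hr3] at hne
    rw [← chainSum_stepWeight x y n d hr2 m hm', poch_sub_div_factorial_sub hm' hne]
    have e : poch (nu x y (d + 1)) n
        = poch (nu x y (d + 1)) m * poch (nu x y (d + 1) + m) (n - m) := by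
      rw [← poch_add, Nat.add_sub_cancel' hm']
    simp only [hh, e, hr3]
    ring
  rw [e1] at key
  have e2 : term₁ (d + 2) x y n = fun l : Fin d → ℕ =>
      (∏ i : Fin d, stepWeight x y i.val (partialSum l i.val) (partialSum l (i.val + 1)))
          * h (partialSum l d) := by
    funext l
    change poch (nu x y (d + 1)) n * poch (y (d + 2) - x (d + 1)) n / (n.factorial : ℂ)
      * (poch (-n) (partialSum l d) / poch (1 - y (d + 2) + x (d + 1) - n) (partialSum l d)
      * ∏ i : Fin d, poch (nu x y (i.val + 1)) (partialSum l (i.val + 1))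
            * poch (y (i.val + 2) - x (i.val + 1)) (l i)
            / (poch (nu x y (i.val + 2)) (partialSum l (i.val + 1)) * ((l i).factorial : ℂ))) = _
    rw [← mul_assoc, mul_comm]
    congr 1
    refine prod_congr rfl fun i _ => ?_
    rw [stepWeight, partialSum_succ, Nat.add_sub_cancel_left]
  rw [e2]
  exact key

/-! ### The second multiple series, for odd and even `p` -/

lemma psi_succ (x y : ℕ → ℂ) (m : ℕ) :
    psi x y (m + 2) = psi x y (m + 1) + y (m + 2) - x (m + 1) := by
  simp only [psi, Nat.add_sub_cancel, show m + 2 - 1 = m + 1 by omega]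
  rw [sum_Icc_succ_top (by omega : 1 ≤ m + 1 + 1) y, sum_Icc_succ_top (by omega : 1 ≤ m + 1) x]
  ring

lemma nu_eq_psi_sub (x y : ℕ → ℂ) (m : ℕ) : nu x y (m + 1) = psi x y (m + 1) - x (m + 1) := by
  simp only [nu, psi, Nat.add_sub_cancel, sum_sub_distrib]
  rw [sum_Icc_succ_top (by omega : 1 ≤ m + 1) x]
  ring

/-- The two parameters of the `i`-th step in the second multiple series, `p` telling by its
parity whether the step comes from `𝐱` or from `𝐲`. -/
def stepPoch (p : ℕ) (x y : ℕ → ℂ) (i m : ℕ) : ℂ :=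
  if Even (i + p) then poch (psi x y (i + 2) - y (i + 1)) m * poch (psi x y (i + 2) - y (i + 2)) m
  else poch (psi x y (i + 1) - x (i + 1)) m * poch (psi x y (i + 1) - x (i + 2)) m

/-- The weights of the steps in the second multiple series. -/
def altWeight (p : ℕ) (x y : ℕ → ℂ) (i j m : ℕ) : ℂ :=
  (if Even (i + p) then 1 else (-1) ^ (m - j)) / ((m - j).factorial : ℂ)
    * (stepPoch p x y i m / stepPoch p x y i j)

lemma stepPoch_zero (p : ℕ) (x y : ℕ → ℂ) (i : ℕ) : stepPoch p x y i 0 = 1 := by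
  simp [stepPoch]

/-- Two steps of the recurrence for Nørlund's coefficients. -/
lemma coeffG_two_steps (x y : ℕ → ℂ) (d n : ℕ) :
    coeffG x y (d + 3) n = ∑ m ∈ range (n + 1), coeffG x y (d + 1) m *
      ∑ j ∈ Ico m (n + 1), (-1) ^ (j - m) / (((j - m).factorial : ℂ) * ((n - j).factorial : ℂ))
        * (poch (psi x y (d + 1) - x (d + 1) + m) (j - m)
          * poch (psi x y (d + 1) - x (d + 2) + m) (j - m)
          * poch (psi x y (d + 3) - y (d + 2) + j) (n - j)
          * poch (psi x y (d + 3) - y (d + 3) + j) (n - j)) := by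
  rw [coeffG_succ]
  simp only [coeffG_succ x y d, mul_sum]
  rw [sum_comm' (t' := range (n + 1)) (s' := fun j => Ico j (n + 1))
    (by intro a b; simp only [mem_range, mem_Ico]; omega)]
  refine sum_congr rfl fun m hm => ?_
  rw [← mul_sum]
  have hm' : m ≤ n := Nat.lt_succ_iff.mp (mem_range.mp hm)
  -- The parameters are chosen so that `D - B` and `C - A` are the differences `y - x` of the two
  -- steps, while `A` and `D` are the two `ν` shifted by `m`.
  have T := threeFTwo_transform (psi x y (d + 1) - x (d + 1) + m)
    (psi x y (d + 1) - x (d + 2) + m) (psi x y (d + 3) - y (d + 2) + m)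
    (psi x y (d + 3) - y (d + 3) + m) (n - m)
  rw [Nat.sum_antidiagonal_eq_sum_range_succ_mk, Nat.sum_antidiagonal_eq_sum_range_succ_mk] at T
  rw [sum_Ico_eq_sum_range, sum_Ico_eq_sum_range, show n + 1 - m = (n - m).succ by omega]
  have h1 := psi_succ x y d
  have h2 := psi_succ x y (d + 1)
  have h3 := nu_eq_psi_sub x y d
  have h4 := nu_eq_psi_sub x y (d + 1)
  simp only [show d + 1 + 2 = d + 3 by omega, show d + 1 + 1 = d + 2 by omega] at h1 h2 h3 h4 ⊢
  have e1 : psi x y (d + 3) - y (d + 3) + m - (psi x y (d + 1) - x (d + 2) + m)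
    = y (d + 2) - x (d + 1) := by rw [h2, h1]; ring
  have e2 : psi x y (d + 3) - y (d + 2) + m - (psi x y (d + 1) - x (d + 1) + m)
    = y (d + 3) - x (d + 2) := by rw [h2, h1]; ring
  have e3 : psi x y (d + 3) - y (d + 3) = nu x y (d + 2) := by rw [h2, h4]; ring
  rw [e1, e2] at T
  calc _ = coeffG x y (d + 1) m * ∑ k ∈ range (n - m).succ,
        poch (y (d + 2) - x (d + 1)) k / (k.factorial : ℂ)
        * poch (psi x y (d + 1) - x (d + 1) + m) k
        * (poch (y (d + 3) - x (d + 2)) (n - m - k) / ((n - m - k).factorial : ℂ)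
        * poch (psi x y (d + 3) - y (d + 3) + m + k) (n - m - k)) := by
        rw [mul_sum]
        refine sum_congr rfl fun k hk => ?_
        rw [Nat.add_sub_cancel_left, Nat.sub_add_eq, e3, h3]
        push_cast
        simp only [add_assoc]
        ring
    _ = _ := by
        rw [T]
        congr 1
        refine sum_congr rfl fun k hk => ?_
        rw [Nat.add_sub_cancel_left, Nat.sub_add_eq]
        push_cast
        simp only [add_assoc]

lemma chainSum_two_steps (W : ℕ → ℕ → ℕ → ℂ) (d n : ℕ) :
    chainSum W (d + 2) n = ∑ m ∈ range (n + 1), chainSum W d m *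
      ∑ j ∈ Ico m (n + 1), W d m j * W (d + 1) j n := by
  simp only [chainSum, sum_mul, mul_sum]
  rw [sum_comm' (t' := range (n + 1)) (s' := fun j => Ico j (n + 1))
    (by intro a b; simp only [mem_range, mem_Ico]; omega)]
  refine sum_congr rfl fun m _ => sum_congr rfl fun j _ => by ring

lemma stepPoch_ne_zero_of_le {p : ℕ} {x y : ℕ → ℂ} {i m n : ℕ} (h : m ≤ n)
    (hn : stepPoch p x y i n ≠ 0) : stepPoch p x y i m ≠ 0 := by
  unfold stepPoch at hn ⊢
  split_ifs at hn ⊢ <;>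
  exact mul_ne_zero (poch_ne_zero_of_le h (left_ne_zero_of_mul hn))
    (poch_ne_zero_of_le h (right_ne_zero_of_mul hn))

/-- The chains of the second multiple series give Nørlund's coefficients. -/
lemma chainSum_altWeight (p : ℕ) (x y : ℕ → ℂ) (n d : ℕ) (hpar : Odd (d + p))
    (hreg : ∀ i, i ≠ 0 → i < d → stepPoch p x y i n ≠ 0) (m : ℕ) (hm : m ≤ n) :
    chainSum (altWeight p x y) d m = coeffG x y (d + 1) m := by
  induction d using Nat.twoStepInduction generalizing m with
  | zero => simp [chainSum, coeffG]
  | one =>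
    have hpar' : Even p := by
      rcases Nat.even_or_odd p with h | h
      · exact h
      · exact absurd hpar (Nat.not_odd_iff_even.mpr (by simpa using odd_one.add_odd h))
    -- Here `ψ₂ - y₁ = y₂ - x₁` and `ψ₂ - y₂ = ν₁`, so the single step is already the recurrence.
    simp [chainSum, coeffG, altWeight, stepPoch, hpar', psi, nu, sum_Icc_succ_top]
    ring_nf
  | more d ih _ =>
    have hpd : Odd (d + p) := by
      have : d + 2 + p = (d + p) + 2 := by omega
      rw [this, Nat.odd_add] at hpar
      exact hpar.mpr even_two
    have hne : ¬ Even (d + p) := Nat.not_even_iff_odd.mpr hpd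
    have hev : Even (d + 1 + p) := by
      rw [show d + 1 + p = d + p + 1 by omega]; exact hpd.add_one
    rw [chainSum_two_steps, coeffG_two_steps]
    refine sum_congr rfl fun k hk => ?_
    have hk' : k ≤ m := Nat.lt_succ_iff.mp (mem_range.mp hk)
    rw [ih hpd (fun i h0 hi => hreg i h0 (by omega)) k (hk'.trans hm)]
    -- For `d = 0` only the chain at `k = 0` has nonzero weight, so the step with `i = 0` needs no
    -- regularity: its only relevant denominator is `(⬝)_0 = 1`.
    by_cases hk0 : d = 0 ∧ k ≠ 0
    · obtain ⟨rfl, h⟩ := hk0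
      simp [coeffG, h]
    congr 1
    refine sum_congr rfl fun j hj => ?_
    obtain ⟨hkj, hjm⟩ := mem_Ico.mp hj
    have hjm' : j ≤ m := Nat.lt_succ_iff.mp hjm
    have s1 : stepPoch p x y d k ≠ 0 := by
      rcases eq_or_ne k 0 with rfl | h
      · simp [stepPoch_zero]
      · exact stepPoch_ne_zero_of_le (hk'.trans hm) (hreg d (fun h' => hk0 ⟨h', h⟩) (by omega))
    have s2 : stepPoch p x y (d + 1) j ≠ 0 :=
      stepPoch_ne_zero_of_le (hjm'.trans hm) (hreg _ (by omega) (by omega))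
    simp only [altWeight, hne, hev, if_true, if_false]
    simp only [stepPoch, hne, hev, if_true, if_false] at s1 s2 ⊢
    rw [poch_shift hkj (left_ne_zero_of_mul s1), poch_shift hkj (right_ne_zero_of_mul s1),
      poch_shift hjm' (left_ne_zero_of_mul s2), poch_shift hjm' (right_ne_zero_of_mul s2)]
    ring

/-- The last of the `d + 1` steps ends at `n` and is therefore not a free index; it becomes the end
weight. The cutoff is explicit because truncated subtraction would not make this weight vanish
beyond `n`. -/
lemma hasSum_altWeight (x y : ℕ → ℂ) (n d : ℕ)
    (hreg : ∀ i, i ≠ 0 → i < d + 1 → stepPoch (d + 2) x y i n ≠ 0) :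
    HasSum (fun l : Fin d → ℕ =>
        (∏ i : Fin d, altWeight (d + 2) x y i.val (partialSum l i.val) (partialSum l (i.val + 1)))
          * if partialSum l d ≤ n then altWeight (d + 2) x y d (partialSum l d) n else 0)
      (coeffG x y (d + 2) n) := by
  have key := hasSum_chain (altWeight (d + 2) x y) n d
    (fun m => if m ≤ n then altWeight (d + 2) x y d m n else 0)
    fun m hm => if_neg (not_le.mpr hm)
  rw [← chainSum_altWeight (d + 2) x y n (d + 1) ⟨d + 1, by ring⟩ hreg n le_rfl, chainSum]
  convert key using 1
  refine sum_congr rfl fun m hm => ?_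
  rw [if_pos (Nat.lt_succ_iff.mp (mem_range.mp hm))]

/-- The factor `(-n)_{|𝐥|} / n!` contributes `(-1)^{|𝐥|}`, which moves the signs from the steps of
one parity to those of the other. -/
lemma sign_factor_eq {n d : ℕ} (p : ℕ) (l : Fin d → ℕ) (hl : partialSum l d ≤ n) :
    poch (-n) (partialSum l d) * (∏ i : Fin d, if Even (i.val + p) then (-1) ^ l i else 1)
        / ((∏ i : Fin d, ((l i).factorial : ℂ)) * (n.factorial : ℂ))
      = (∏ i : Fin d, (if Even (i.val + p) then 1 else (-1) ^ l i) / ((l i).factorial : ℂ))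
        * (1 / ((n - partialSum l d).factorial : ℂ)) := by
  have e : partialSum l d = ∑ i, l i := by simp [partialSum]
  have h1 := poch_neg_div_factorial hl
  have h2 : (-1 : ℂ) ^ partialSum l d * ∏ i : Fin d, (if Even (i.val + p) then (-1) ^ l i else 1)
      = ∏ i : Fin d, (if Even (i.val + p) then 1 else (-1) ^ l i) := by
    rw [e, ← prod_pow_eq_pow_sum, ← prod_mul_distrib]
    refine prod_congr rfl fun i _ => ?_
    split_ifs
    · rw [← mul_pow]; simp
    · simp
  rw [prod_div_distrib, ← h2]
  calc _ = poch (-n) (partialSum l d) / (n.factorial : ℂ)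
        * (∏ i : Fin d, if Even (i.val + p) then (-1) ^ l i else 1)
        / (∏ i : Fin d, ((l i).factorial : ℂ)) := by
          rw [mul_comm (∏ i : Fin d, ((l i).factorial : ℂ)), ← div_div, mul_div_right_comm]
    _ = _ := by rw [h1]; ring

lemma prod_altWeight_eq (x y : ℕ → ℂ) {n d : ℕ} (l : Fin d → ℕ) :
    (∏ i : Fin d, altWeight (d + 2) x y i.val (partialSum l i.val) (partialSum l (i.val + 1)))
        * altWeight (d + 2) x y d (partialSum l d) n
      = (∏ i : Fin d, (if Even (i.val + (d + 2)) then 1 else (-1) ^ l i) / ((l i).factorial : ℂ))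
        * (1 / ((n - partialSum l d).factorial : ℂ))
        * ∏ i ∈ range (d + 1), stepPoch (d + 2) x y i (partialSumTo (d + 2) n l (i + 1))
          / stepPoch (d + 2) x y i (partialSumTo (d + 2) n l i) := by
  have hps : ∀ m, m ≤ d → partialSumTo (d + 2) n l m = partialSum l m := fun m hm =>
    if_neg (by omega)
  have hps' : partialSumTo (d + 2) n l (d + 1) = n := if_pos rfl
  have hd : Even (d + (d + 2)) := ⟨d + 1, by ring⟩
  rw [prod_range_succ, hps', hps d le_rfl, ← Fin.prod_univ_eq_prod_range
    (fun i => stepPoch (d + 2) x y i (partialSumTo (d + 2) n l (i + 1))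
          / stepPoch (d + 2) x y i (partialSumTo (d + 2) n l i)) d]
  have : ∀ i : Fin d, altWeight (d + 2) x y i.val (partialSum l i.val) (partialSum l (i.val + 1))
      = (if Even (i.val + (d + 2)) then 1 else (-1) ^ l i) / ((l i).factorial : ℂ)
        * (stepPoch (d + 2) x y i (partialSumTo (d + 2) n l (i + 1))
          / stepPoch (d + 2) x y i (partialSumTo (d + 2) n l i)) := fun i => by
    rw [altWeight, hps _ i.isLt.le, hps _ i.isLt, partialSum_succ, Nat.add_sub_cancel_left]
  simp only [this, prod_mul_distrib]
  rw [altWeight, if_pos hd]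
  ring

lemma prod_even_Icc (k : ℕ) (F : ℕ → ℂ) :
    ∏ m ∈ (Icc 2 (2 * k + 1)).filter Even, F m = ∏ t ∈ range k, F (2 * t + 2) := by
  induction k with
  | zero => simp
  | succ k ih =>
    rw [prod_range_succ, ← ih]
    have : (Icc 2 (2 * (k + 1) + 1)).filter Even
        = insert (2 * k + 2) ((Icc 2 (2 * k + 1)).filter Even) := by
      ext m
      simp only [mem_filter, mem_Icc, mem_insert, Nat.even_iff]
      omega
    rw [this, prod_insert (by simp), mul_comm]

lemma prod_even_Icc' (k : ℕ) (F : ℕ → ℂ) :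
    ∏ m ∈ (Icc 2 (2 * k)).filter Even, F m = ∏ t ∈ range k, F (2 * t + 2) := by
  rw [← prod_even_Icc]
  congr 1
  ext m
  simp only [mem_filter, mem_Icc, Nat.even_iff]
  omega

lemma prod_range_two_mul (k : ℕ) (r : ℕ → ℂ) :
    ∏ i ∈ range (2 * k), r i = ∏ t ∈ range k, r (2 * t) * r (2 * t + 1) := by
  induction k with
  | zero => simp
  | succ k ih =>
    rw [show 2 * (k + 1) = 2 * k + 1 + 1 by ring, prod_range_succ, prod_range_succ,
      prod_range_succ, ih, mul_assoc]

/-- The second multiple series for odd `p` sums to Nørlund's coefficient. -/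
lemma hasSum_termOdd (p : ℕ) (hp : 3 ≤ p) (hodd : Odd p) (x y : ℕ → ℂ) (n : ℕ)
    (hreg : RegularOdd p x y n) : HasSum (termOdd p x y n) (coeffG x y p n) := by
  obtain ⟨k, hk⟩ := hodd
  obtain ⟨k, rfl⟩ : ∃ j, k = j + 1 := ⟨k - 1, by omega⟩
  obtain ⟨d, hd⟩ : ∃ d, d = 2 * k + 1 := ⟨_, rfl⟩
  obtain rfl : p = d + 2 := by omega
  have hreg' : ∀ i, i ≠ 0 → i < d + 1 → stepPoch (d + 2) x y i n ≠ 0 := by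
    intro i h0 hi
    rw [stepPoch]
    split_ifs with hpar
    · have h := hreg (i + 1) (by
        simp only [mem_filter, mem_Icc, Nat.even_iff] at hpar ⊢; omega)
      exact mul_ne_zero h.2.1 h.2.2
    · have h := hreg (i + 2) (by
        simp only [mem_filter, mem_Icc, Nat.even_iff] at hpar ⊢; omega)
      have h' := h.1 (by omega)
      exact mul_ne_zero h'.1 h'.2
  have key := hasSum_altWeight x y n d hreg'
  refine Eq.mpr (congrArg (fun f : (Fin d → ℕ) → ℂ => HasSum f (coeffG x y (d + 2) n)) ?_) key
  funext l
  -- `Fin (d + 2 - 2)` is `Fin d` by definition.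
  change Fin d → ℕ at l
  change poch (-n) (partialSum l d)
      * (∏ i : Fin d, if Even (i.val + 1) then (-1) ^ l i else 1)
      / ((∏ i : Fin d, ((l i).factorial : ℂ)) * (n.factorial : ℂ)) * _ = _
  by_cases hl : partialSum l d ≤ n
  · have hsgn : ∀ i : Fin d, Even (i.val + 1) ↔ Even (i.val + (d + 2)) := fun i => by
      simp only [Nat.even_iff]; omega
    simp only [hsgn]
    rw [if_pos hl, sign_factor_eq (d := d) _ l hl, prod_altWeight_eq]
    congr 1
    rw [show d + 2 - 1 = 2 * (k + 1) by omega, prod_even_Icc', show d + 1 = 2 * (k + 1) by omega,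
      prod_range_two_mul]
    -- The factor with `m = 2t + 2` collects the `𝐱`-step `2t` and the `𝐲`-step `2t + 1`.
    refine prod_congr rfl fun t _ => ?_
    have h1 : ¬ Even (2 * t + (d + 2)) := by simp only [Nat.even_iff]; omega
    have h2 : Even (2 * t + 1 + (d + 2)) := by simp only [Nat.even_iff]; omega
    simp only [stepPoch, h1, h2, if_true, if_false, show 2 * t + 2 - 1 = 2 * t + 1 by omega,
      show 2 * t + 2 - 2 = 2 * t by omega, show 2 * t + 1 + 1 = 2 * t + 2 by omega,
      show 2 * t + 1 + 2 = 2 * t + 3 by omega]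
    rw [div_mul_div_comm]
    simp only [mul_assoc]
  · rw [if_neg hl, poch_neg_of_lt (not_le.mp hl)]
    simp

/-- The second multiple series for even `p` sums to Nørlund's coefficient. -/
lemma hasSum_termEven (p : ℕ) (hp : 4 ≤ p) (heven : Even p) (x y : ℕ → ℂ) (n : ℕ)
    (hreg : RegularEven p x y n) : HasSum (termEven p x y n) (coeffG x y p n) := by
  obtain ⟨k, hk⟩ := heven
  obtain ⟨k, rfl⟩ : ∃ j, k = j + 2 := ⟨k - 2, by omega⟩
  obtain ⟨d, hd⟩ : ∃ d, d = 2 * (k + 1) := ⟨_, rfl⟩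
  obtain rfl : p = d + 2 := by omega
  have hreg' : ∀ i, i ≠ 0 → i < d + 1 → stepPoch (d + 2) x y i n ≠ 0 := by
    intro i h0 hi
    rw [stepPoch]
    split_ifs with hpar
    · have h := hreg i (by
        simp only [mem_filter, mem_Icc, Nat.even_iff] at hpar ⊢; omega)
      exact mul_ne_zero h.2.2.1 h.2.2.2
    · have h := hreg (i + 1) (by
        simp only [mem_filter, mem_Icc, Nat.even_iff] at hpar ⊢; omega)
      exact mul_ne_zero h.1 h.2.1
  have key := hasSum_altWeight x y n d hreg'
  refine Eq.mpr (congrArg (fun f : (Fin d → ℕ) → ℂ => HasSum f (coeffG x y (d + 2) n)) ?_) key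
  funext l
  change Fin d → ℕ at l
  change poch (-n) (partialSum l d)
      * (∏ i : Fin d, if Odd (i.val + 1) then (-1) ^ l i else 1)
      / ((∏ i : Fin d, ((l i).factorial : ℂ)) * (n.factorial : ℂ)) * _ * _ = _
  by_cases hl : partialSum l d ≤ n
  · have hsgn : ∀ i : Fin d, Odd (i.val + 1) ↔ Even (i.val + (d + 2)) := fun i => by
      simp only [Nat.even_iff, Nat.odd_iff]; omega
    simp only [hsgn]
    rw [if_pos hl, sign_factor_eq (d := d) _ l hl, prod_altWeight_eq, mul_assoc]
    congr 1
    -- Step `0` is split off, as it gives the factor in front of the product; the remaining steps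
    -- pair up as `2t + 1`, `2t + 2`.
    rw [show Icc 2 (d + 2 - 2) = Icc 2 (2 * (k + 1)) from congrArg (Icc 2) (by omega),
      prod_even_Icc', prod_range_succ' _ d, mul_comm,
      show range d = range (2 * (k + 1)) by rw [hd], prod_range_two_mul]
    congr 1
    · refine prod_congr rfl fun t _ => ?_
      have h1 : ¬ Even (2 * t + 1 + (d + 2)) := by simp only [Nat.even_iff]; omega
      have h2 : Even (2 * t + 2 + (d + 2)) := by simp only [Nat.even_iff]; omega
      simp only [show 2 * t + 1 + 1 = 2 * t + 2 by omega]
      simp only [stepPoch, h1, h2, if_true, if_false, show 2 * t + 2 - 1 = 2 * t + 1 by omega,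
        show 2 * t + 1 + 1 = 2 * t + 2 by omega,
        show 2 * t + 1 + 2 = 2 * t + 3 by omega]
      rw [div_mul_div_comm]
      simp only [mul_assoc]
    · have h0 : Even (0 + (d + 2)) := by simp only [Nat.even_iff]; omega
      have p0 : partialSumTo (d + 2) n l 0 = 0 := by
        rw [partialSumTo, if_neg (by omega)]; exact partialSum_zero (d := d) l
      have p1 : partialSumTo (d + 2) n l (0 + 1) = partialSum l 1 := if_neg (by omega)
      rw [p0, p1, stepPoch_zero, stepPoch, if_pos h0, div_one, mul_comm]
  · rw [if_neg hl, poch_neg_of_lt (not_le.mp hl)]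
    simp

/-! ### The single sum, through formal Stirling series -/

section Formal

/-! ### Polynomial functions -/

/-- The function `f` is given by a polynomial. -/
def IsPoly (f : ℂ → ℂ) : Prop := ∃ P : Polynomial ℂ, ∀ a, f a = P.eval a

namespace IsPoly

lemma const (c : ℂ) : IsPoly fun _ => c := ⟨Polynomial.C c, fun _ => by simp⟩

lemma id : IsPoly fun a => a := ⟨Polynomial.X, fun _ => by simp⟩

lemma add {f g : ℂ → ℂ} (hf : IsPoly f) (hg : IsPoly g) : IsPoly fun a => f a + g a := by
  obtain ⟨P, hP⟩ := hf
  obtain ⟨Q, hQ⟩ := hg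
  exact ⟨P + Q, fun a => by simp [hP, hQ]⟩

lemma mul {f g : ℂ → ℂ} (hf : IsPoly f) (hg : IsPoly g) : IsPoly fun a => f a * g a := by
  obtain ⟨P, hP⟩ := hf
  obtain ⟨Q, hQ⟩ := hg
  exact ⟨P * Q, fun a => by simp [hP, hQ]⟩

lemma neg {f : ℂ → ℂ} (hf : IsPoly f) : IsPoly fun a => -f a := by
  obtain ⟨P, hP⟩ := hf
  exact ⟨-P, fun a => by simp [hP]⟩

lemma sub {f g : ℂ → ℂ} (hf : IsPoly f) (hg : IsPoly g) : IsPoly fun a => f a - g a := by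
  simpa [sub_eq_add_neg] using hf.add hg.neg

lemma div_const {f : ℂ → ℂ} (hf : IsPoly f) (c : ℂ) : IsPoly fun a => f a / c := by
  simpa [div_eq_mul_inv] using hf.mul (const c⁻¹)

lemma sum {ι : Type*} (s : Finset ι) {f : ι → ℂ → ℂ} (hf : ∀ i ∈ s, IsPoly (f i)) :
    IsPoly fun a => ∑ i ∈ s, f i a := by
  classical
  induction s using Finset.induction_on with
  | empty => simpa using const 0
  | insert i s hi ih =>
    simp only [sum_insert hi]
    exact (hf i (mem_insert_self i s)).add (ih fun j hj => hf j (mem_insert_of_mem hj))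

lemma comp {f g : ℂ → ℂ} (hf : IsPoly f) (hg : IsPoly g) : IsPoly fun a => f (g a) := by
  obtain ⟨P, hP⟩ := hf
  obtain ⟨Q, hQ⟩ := hg
  exact ⟨P.comp Q, fun a => by simp [hP, hQ]⟩

/-- Polynomial functions agreeing at all non-positive integers are equal. -/
lemma eq_of_neg_nat {f g : ℂ → ℂ} (hf : IsPoly f) (hg : IsPoly g)
    (h : ∀ N : ℕ, f (-N) = g (-N)) (a : ℂ) : f a = g a := by
  obtain ⟨P, hP⟩ := hf
  obtain ⟨Q, hQ⟩ := hg
  have : P = Q := by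
    refine Polynomial.eq_of_infinite_eval_eq P Q
      ((Set.infinite_range_of_injective (f := fun N : ℕ => -(N : ℂ)) ?_).mono ?_)
    · intro m n hmn
      simpa using hmn
    · rintro _ ⟨N, rfl⟩
      simpa [hP, hQ] using h N
  rw [hP, hQ, this]

end IsPoly

lemma isPoly_poch (k : ℕ) : IsPoly fun a => poch a k := ⟨ascPochhammer ℂ k, fun _ => rfl⟩

lemma isPoly_bernoulliC (m : ℕ) : IsPoly (bernoulliC m) :=
  ⟨(Polynomial.bernoulli m).map (algebraMap ℚ ℂ), fun a => by
    rw [bernoulliC, Polynomial.aeval_def, Polynomial.eval_map]⟩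

lemma bernoulliC_add_one (m : ℕ) (b : ℂ) :
    bernoulliC (m + 1) (b + 1) = bernoulliC (m + 1) b + (m + 1) * b ^ m := by
  have h := congrArg (Polynomial.aeval b) (Polynomial.bernoulli_comp_one_add_X (m + 1))
  rw [Polynomial.aeval_comp] at h
  simpa [bernoulliC, add_comm] using h

open PowerSeries

/-! ### The exponential of a power series -/

/-- A first-order linear differential equation determines all coefficients recursively from the
constant term. The rules for exponentials and the formal functional equation of gamma rest on this.
-/
lemma eq_of_derivative_eq_mul {f g M : ℂ⟦X⟧} (hf : d⁄dX ℂ f = f * M) (hg : d⁄dX ℂ g = g * M)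
    (h0 : constantCoeff f = constantCoeff g) : f = g := by
  ext n
  induction n using Nat.strong_induction_on with
  | _ n ih =>
    cases n with
    | zero => simpa using h0
    | succ n =>
      have e1 := congrArg (coeff n) hf
      have e2 := congrArg (coeff n) hg
      rw [coeff_derivative, coeff_mul] at e1 e2
      have : coeff (n + 1) f * ((n : ℂ) + 1) = coeff (n + 1) g * ((n : ℂ) + 1) := by
        rw [e1, e2]
        refine sum_congr rfl fun ij hij => ?_
        have : ij.1 + ij.2 = n := by simpa using hij
        rw [ih ij.1 (by omega)]
      exact mul_right_cancel₀ (Nat.cast_add_one_ne_zero n) this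

/-- The exponential `exp L` of a power series without constant term. -/
def expOf (L : ℂ⟦X⟧) : ℂ⟦X⟧ := (exp ℂ).subst L

lemma derivative_expOf {L : ℂ⟦X⟧} (hL : constantCoeff L = 0) :
    d⁄dX ℂ (expOf L) = expOf L * d⁄dX ℂ L := by
  rw [expOf, derivative_subst (HasSubst.of_constantCoeff_zero' hL), derivative_exp]

lemma coeff_pow_eq_zero {L : ℂ⟦X⟧} (hL : constantCoeff L = 0) {n d : ℕ} (h : n < d) :
    coeff n (L ^ d) = 0 := by
  obtain ⟨L', rfl⟩ := X_dvd_iff.mpr hL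
  rw [mul_pow, coeff_X_pow_mul', if_neg (by omega)]

lemma coeff_subst_eq_sum {L : ℂ⟦X⟧} (hL : constantCoeff L = 0) (f : ℂ⟦X⟧) (n : ℕ) :
    coeff n (f.subst L) = ∑ d ∈ range (n + 1), coeff d f * coeff n (L ^ d) := by
  rw [coeff_subst' (HasSubst.of_constantCoeff_zero' hL)]
  simp only [smul_eq_mul]
  refine finsum_eq_sum_of_support_subset _ fun d hd => ?_
  simp only [coe_range, Set.mem_Iio]
  by_contra h
  exact hd (by simp only [coeff_pow_eq_zero hL (by omega : n < d), mul_zero])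

lemma constantCoeff_expOf {L : ℂ⟦X⟧} (hL : constantCoeff L = 0) :
    constantCoeff (expOf L) = 1 := by
  rw [← coeff_zero_eq_constantCoeff_apply, expOf, coeff_subst_eq_sum hL]
  simp

lemma expOf_add {L M : ℂ⟦X⟧} (hL : constantCoeff L = 0) (hM : constantCoeff M = 0) :
    expOf (L + M) = expOf L * expOf M := by
  have hLM : constantCoeff (L + M) = 0 := by simp [hL, hM]
  refine eq_of_derivative_eq_mul (M := d⁄dX ℂ (L + M)) (derivative_expOf hLM) ?_ ?_
  · rw [Derivation.leibniz, derivative_expOf hL, derivative_expOf hM, map_add]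
    simp only [smul_eq_mul]
    ring
  · simp [constantCoeff_expOf, hL, hM, hLM]

lemma expOf_zero : expOf 0 = 1 := by
  refine eq_of_derivative_eq_mul (M := 0) ?_ ?_ ?_
  · rw [derivative_expOf (by simp)]; simp
  · simp
  · rw [constantCoeff_expOf (by simp)]; simp

lemma expOf_mul_expOf_neg {L : ℂ⟦X⟧} (hL : constantCoeff L = 0) :
    expOf L * expOf (-L) = 1 := by
  rw [← expOf_add hL (by simp [hL]), add_neg_cancel, expOf_zero]

lemma expOf_sum {ι : Type*} (s : Finset ι) {L : ι → ℂ⟦X⟧}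
    (hL : ∀ i, constantCoeff (L i) = 0) : expOf (∑ i ∈ s, L i) = ∏ i ∈ s, expOf (L i) := by
  classical
  induction s using Finset.induction_on with
  | empty => simp [expOf_zero]
  | insert i s hi ih =>
    rw [sum_insert hi, prod_insert hi, expOf_add (hL i) (by simp [hL]), ih]

/-- The equation `(exp L)' = exp L · L'` gives coefficient `n + 1` of the exponential from lower
ones and from coefficients of `L`, dividing only by `n + 1`. -/
lemma isPoly_coeff_expOf {L : ℂ → ℂ⟦X⟧} (h0 : ∀ a, constantCoeff (L a) = 0)
    (hL : ∀ n, IsPoly fun a => coeff n (L a)) (n : ℕ) :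
    IsPoly fun a => coeff n (expOf (L a)) := by
  induction n using Nat.strong_induction_on with
  | _ n ih =>
    cases n with
    | zero => simpa [constantCoeff_expOf, h0] using IsPoly.const 1
    | succ n =>
      have e : (fun a => coeff (n + 1) (expOf (L a))) = fun a =>
          (∑ ij ∈ antidiagonal n, coeff ij.1 (expOf (L a))
            * (coeff (ij.2 + 1) (L a) * ((ij.2 : ℂ) + 1))) / ((n : ℂ) + 1) := by
        funext a
        have e1 := congrArg (coeff n) (derivative_expOf (h0 a))
        rw [coeff_derivative, coeff_mul] at e1
        rw [eq_div_iff (Nat.cast_add_one_ne_zero n), e1]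
        simp only [coeff_derivative]
      rw [e]
      refine (IsPoly.sum _ fun ij hij => ?_).div_const _
      have : ij.1 + ij.2 = n := by simpa using hij
      exact (ih ij.1 (by omega)).mul ((hL _).mul (IsPoly.const _))

/-! ### The formal Stirling series -/

/-- The formal Stirling series: `log (Γ(z + b) / (√(2π) z ^ (z + b - 1/2) e^{-z}))` is asymptotic
to it at `X = 1 / z`. -/
def stirling (b : ℂ) : ℂ⟦X⟧ :=
  PowerSeries.mk fun m => if m = 0 then 0 else
    (-1) ^ (m + 1) / ((m : ℂ) * (m + 1)) * bernoulliC (m + 1) b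

/-- The formal series of `Γ(z + b)`. -/
def gammaSer (b : ℂ) : ℂ⟦X⟧ := expOf (stirling b)

/-- The formal series of `1 / Γ(z + b)`. -/
def invGammaSer (b : ℂ) : ℂ⟦X⟧ := expOf (-stirling b)

lemma constantCoeff_stirling (b : ℂ) : constantCoeff (stirling b) = 0 := by
  rw [← coeff_zero_eq_constantCoeff_apply, stirling, coeff_mk, if_pos rfl]

lemma gammaSer_mul_invGammaSer (b : ℂ) : gammaSer b * invGammaSer b = 1 :=
  expOf_mul_expOf_neg (constantCoeff_stirling b)

lemma constantCoeff_invGammaSer (b : ℂ) : constantCoeff (invGammaSer b) = 1 :=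
  constantCoeff_expOf (by simp [constantCoeff_stirling])

lemma isPoly_coeff_stirling (n : ℕ) : IsPoly fun b => coeff n (stirling b) := by
  simp only [stirling, coeff_mk]
  split_ifs
  · exact IsPoly.const 0
  · exact (IsPoly.const _).mul (isPoly_bernoulliC _)

lemma isPoly_coeff_gammaSer (n : ℕ) : IsPoly fun b => coeff n (gammaSer b) :=
  isPoly_coeff_expOf constantCoeff_stirling isPoly_coeff_stirling n

lemma isPoly_coeff_invGammaSer (n : ℕ) : IsPoly fun b => coeff n (invGammaSer b) :=
  isPoly_coeff_expOf (fun b => by simp [constantCoeff_stirling])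
    (fun n => by simpa using (isPoly_coeff_stirling n).neg) n

/-- Logarithmic derivative of the functional equation of gamma: the difference of the two
derivatives is the geometric series of `b / (1 + b X)`, by the difference equation of the Bernoulli
polynomials. The factor `1 + b X` clears the denominator. -/
lemma one_add_mul_derivative_stirling (b : ℂ) :
    (1 + C b * X) * d⁄dX ℂ (stirling (b + 1)) = C b + (1 + C b * X) * d⁄dX ℂ (stirling b) := by
  have h : d⁄dX ℂ (stirling (b + 1)) - d⁄dX ℂ (stirling b)
      = PowerSeries.mk fun n => (-1) ^ n * b ^ (n + 1) := by
    ext n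
    have h1 : (n : ℂ) + 1 ≠ 0 := Nat.cast_add_one_ne_zero n
    have h2 : (n : ℂ) + 1 + 1 ≠ 0 := by exact_mod_cast Nat.succ_ne_zero (n + 1)
    rw [map_sub, coeff_derivative, coeff_derivative, stirling, stirling, coeff_mk, coeff_mk,
      coeff_mk, if_neg n.succ_ne_zero, if_neg n.succ_ne_zero, bernoulliC_add_one]
    push_cast
    field_simp
    ring
  have h2 : (1 + C b * X) * (PowerSeries.mk fun n => (-1) ^ n * b ^ (n + 1)) = C b := by
    ext n
    rw [add_mul, one_mul, mul_assoc, map_add, coeff_C_mul, coeff_mk]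
    cases n with
    | zero => simp
    | succ n =>
      rw [coeff_succ_X_mul, coeff_mk, coeff_C, if_neg n.succ_ne_zero]
      ring
  rw [← h, mul_sub] at h2
  linear_combination h2

lemma gammaSer_add_one (b : ℂ) : gammaSer (b + 1) = (1 + C b * X) * gammaSer b := by
  refine eq_of_derivative_eq_mul (M := d⁄dX ℂ (stirling (b + 1)))
    (derivative_expOf (constantCoeff_stirling _)) ?_ ?_
  · rw [Derivation.leibniz, gammaSer, derivative_expOf (constantCoeff_stirling _)]
    have hd : d⁄dX ℂ (1 + C b * X) = C b := by
      simp [Derivation.leibniz]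
    rw [hd]
    simp only [smul_eq_mul]
    linear_combination -expOf (stirling b) * one_add_mul_derivative_stirling b
  · simp [gammaSer, constantCoeff_expOf, constantCoeff_stirling]

lemma gammaSer_add_nat (b : ℂ) (N : ℕ) :
    gammaSer (b + N) = rise X (1 + C b * X) N * gammaSer b := by
  induction N with
  | zero => simp
  | succ N ih =>
    rw [Nat.cast_succ, ← add_assoc, gammaSer_add_one, ih, rise_succ]
    simp only [map_add, map_natCast]
    ring

lemma invGammaSer_eq (b : ℂ) (N : ℕ) :
    invGammaSer b = rise X (1 + C b * X) N * invGammaSer (b + N) := by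
  have h1 := gammaSer_mul_invGammaSer b
  have h2 := gammaSer_mul_invGammaSer (b + N)
  rw [gammaSer_add_nat] at h2
  linear_combination rise X (1 + C b * X) N * invGammaSer (b + N) * h1 - invGammaSer b * h2

/-! ### Formal inverse factorial series -/

/-- The formal sum `∑ₖ gₖ Xᵏ Hₖ`. -/
def triSum (g : ℕ → ℂ) (H : ℕ → ℂ⟦X⟧) : ℂ⟦X⟧ :=
  PowerSeries.mk fun n => ∑ k ∈ range (n + 1), g k * coeff (n - k) (H k)

lemma coeff_triSum (g : ℕ → ℂ) (H : ℕ → ℂ⟦X⟧) (n : ℕ) :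
    coeff n (triSum g H) = ∑ k ∈ range (n + 1), g k * coeff (n - k) (H k) := coeff_mk _ _

/-- The system for the coefficients is triangular with ones on the diagonal. -/
lemma triSum_injective {H : ℕ → ℂ⟦X⟧} (hH : ∀ k, constantCoeff (H k) = 1) {g g' : ℕ → ℂ}
    (h : triSum g H = triSum g' H) : g = g' := by
  funext n
  induction n using Nat.strong_induction_on with
  | _ n ih =>
    have e := congrArg (coeff n) h
    rw [coeff_triSum, coeff_triSum, sum_range_succ, sum_range_succ,
      sum_congr rfl fun k hk => by rw [ih k (mem_range.mp hk)]] at e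
    simpa [hH] using e

lemma coeff_C_mul_X_pow_mul (a : ℂ) (k : ℕ) (F : ℂ⟦X⟧) (n : ℕ) :
    coeff n (C a * X ^ k * F) = if k ≤ n then a * coeff (n - k) F else 0 := by
  rw [mul_assoc, coeff_C_mul, coeff_X_pow_mul']
  split_ifs <;> simp

lemma triSum_eq_sum {N : ℕ} {g : ℕ → ℂ} (hg : ∀ k, N < k → g k = 0) (H : ℕ → ℂ⟦X⟧) :
    triSum g H = ∑ k ∈ range (N + 1), C (g k) * X ^ k * H k := by
  ext n
  rw [coeff_triSum, map_sum]
  simp only [coeff_C_mul_X_pow_mul]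
  rw [← sum_filter]
  refine sum_subset_zero_on_sdiff ?_ ?_ (fun _ _ => rfl) |>.symm
  · intro k hk
    simp only [mem_filter, mem_range] at hk ⊢
    omega
  · intro k hk
    simp only [mem_sdiff, mem_filter, mem_range] at hk
    rw [hg k (by omega), zero_mul]

lemma triSum_mul (g : ℕ → ℂ) (H : ℕ → ℂ⟦X⟧) (A : ℂ⟦X⟧) :
    triSum g H * A = triSum g fun k => H k * A := by
  -- Coefficients up to degree `N` see only the terms with `k ≤ N`, so the formal sum may be
  -- replaced by a finite one.
  have h : ∀ N n, n ≤ N → ∀ K : ℕ → ℂ⟦X⟧, coeff n (triSum g K)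
      = coeff n (∑ k ∈ range (N + 1), C (g k) * X ^ k * K k) := by
    intro N n hn K
    have e := triSum_eq_sum (N := N) (g := fun k => if k ≤ N then g k else 0)
      (fun k hk => if_neg (by omega)) K
    have e2 : ∑ k ∈ range (N + 1), C (g k) * X ^ k * K k
        = ∑ k ∈ range (N + 1), C (if k ≤ N then g k else 0) * X ^ k * K k :=
      sum_congr rfl fun k hk => by rw [if_pos (Nat.lt_succ_iff.mp (mem_range.mp hk))]
    rw [e2, ← e, coeff_triSum, coeff_triSum]
    refine sum_congr rfl fun k hk => ?_
    rw [if_pos (by have := mem_range.mp hk; omega)]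
  ext n
  rw [h n n le_rfl, coeff_mul]
  have e : ∑ k ∈ range (n + 1), C (g k) * X ^ k * (H k * A)
      = (∑ k ∈ range (n + 1), C (g k) * X ^ k * H k) * A := by
    rw [sum_mul]
    exact sum_congr rfl fun k _ => by ring
  rw [e, coeff_mul]
  refine sum_congr rfl fun ij hij => ?_
  have : ij.1 + ij.2 = n := by simpa using hij
  rw [h n ij.1 (by omega)]

lemma triSum_const (f F : ℂ⟦X⟧) : f * F = triSum (fun r => coeff r f) fun _ => F := by
  ext n
  rw [coeff_mul, coeff_triSum, Nat.sum_antidiagonal_eq_sum_range_succ_mk]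

/-- Composition of triangular expansions. -/
lemma triSum_comp (g : ℕ → ℂ) (t : ℕ → ℕ → ℂ) (H K : ℕ → ℂ⟦X⟧)
    (hK : ∀ m, K m = triSum (t m) fun k => H (m + k)) :
    triSum g K = triSum (fun n => ∑ m ∈ range (n + 1), g m * t m (n - m)) H := by
  ext n
  simp only [coeff_triSum, hK, mul_sum, sum_mul]
  symm
  rw [sum_comm' (t' := range (n + 1)) (s' := fun m => Ico m (n + 1))
    (by intro a b; simp only [mem_range, mem_Ico]; omega)]
  refine sum_congr rfl fun m hm => ?_
  have hm' : m ≤ n := Nat.lt_succ_iff.mp (mem_range.mp hm)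
  rw [sum_Ico_eq_sum_range, show n + 1 - m = n - m + 1 by omega]
  refine sum_congr rfl fun k _ => ?_
  rw [Nat.add_sub_cancel_left, Nat.sub_add_eq, mul_assoc]

lemma rise_C_mul_X (b : ℂ) (k : ℕ) : rise X (C b * X) k = C (poch b k) * X ^ k := by
  induction k with
  | zero => simp
  | succ k ih =>
    rw [rise_succ, ih, poch_succ, pow_succ]
    simp only [map_mul, map_add, map_natCast]
    ring

/-- The formal version of Gauss' summation theorem. -/
lemma gammaSer_gauss (x y c : ℂ) :
    gammaSer x * invGammaSer y * invGammaSer c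
      = triSum (fun k => poch (y - x) k * poch (c - x) k / (k.factorial : ℂ))
        fun k => invGammaSer (c + (y - x) + k) := by
  -- With `a = y - x` as variable and `y`, `c` fixed, each coefficient is a polynomial in `a`, and
  -- at `a = -N` the sum terminates.
  suffices h : ∀ a : ℂ, gammaSer (y - a) * invGammaSer y * invGammaSer c
      = triSum (fun k => poch a k * poch (c - y + a) k / (k.factorial : ℂ))
        fun k => invGammaSer (c + a + k) by
    have := h (y - x)
    rwa [show y - (y - x) = x by ring, show c - y + (y - x) = c - x by ring] at this
  intro a
  ext n
  refine IsPoly.eq_of_neg_nat (f := fun a => coeff n (gammaSer (y - a) * invGammaSer y *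
    invGammaSer c)) (g := fun a => coeff n (triSum (fun k => poch a k * poch (c - y + a) k /
      (k.factorial : ℂ)) fun k => invGammaSer (c + a + k))) ?_ ?_ ?_ a
  · simp only [mul_assoc, coeff_mul n (gammaSer _)]
    exact IsPoly.sum _ fun ij _ => ((isPoly_coeff_gammaSer _).comp
      ((IsPoly.const y).sub IsPoly.id)).mul (IsPoly.const _)
  · simp only [coeff_triSum]
    refine IsPoly.sum _ fun k _ => (((isPoly_poch k).mul ((isPoly_poch k).comp
      ((IsPoly.const (c - y)).add IsPoly.id))).div_const _).mul
      ((isPoly_coeff_invGammaSer _).comp (((IsPoly.const c).add IsPoly.id).add (IsPoly.const _)))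
  · intro N
    congr 1
    rw [triSum_eq_sum (N := N) (fun k hk => by rw [poch_neg_of_lt hk]; simp), sub_neg_eq_add,
      gammaSer_add_nat, mul_assoc _ (gammaSer y), gammaSer_mul_invGammaSer, mul_one]
    -- The terminating case is the alternating Chu–Vandermonde identity with increment `w = X`.
    have e : (1 + C y * X : ℂ⟦X⟧) = (1 + C (c - N) * X) - C (c - y - N) * X := by
      simp only [map_sub, map_natCast]; ring
    rw [e, rise_sub, Nat.sum_antidiagonal_eq_sum_range_succ_mk, sum_mul]
    refine sum_congr rfl fun k hk => ?_
    have hk' : k ≤ N := Nat.lt_succ_iff.mp (mem_range.mp hk)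
    have e2 : c + -(N : ℂ) + k + (N - k : ℕ) = c := by rw [Nat.cast_sub hk']; ring
    have e3 : (1 + C (c + -(N : ℂ) + k) * X : ℂ⟦X⟧) = 1 + C (c - N) * X + (k : ℂ⟦X⟧) * X := by
      simp only [map_add, map_sub, map_neg, map_natCast]; ring
    have e4 : poch (-N) k / (k.factorial : ℂ) = (-1) ^ k * (N.choose k : ℂ) := by
      have h1 := poch_neg_mul_factorial hk'
      rw [choose_div_factorial (Nat.add_sub_cancel' hk'), mul_div_assoc',
        div_eq_div_iff (factorial_cast_ne_zero _)
          (mul_ne_zero (factorial_cast_ne_zero _) (factorial_cast_ne_zero _))]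
      linear_combination (k.factorial : ℂ) * h1
    rw [invGammaSer_eq (c + -N + k) (N - k), e2, e3]
    simp only [rise_C_mul_X]
    have e5 : poch (-N) k * poch (c - y + -N) k / (k.factorial : ℂ)
        = (-1) ^ k * (N.choose k : ℂ) * poch (c - y - N) k := by
      rw [← e4, sub_eq_add_neg (c - y)]; ring
    rw [e5]
    simp only [map_mul, map_pow, map_neg, map_one, map_natCast]
    ring

/-- The formal inverse factorial expansion of a ratio of gamma functions. -/
lemma prod_gammaSer_eq (x y : ℕ → ℂ) (p : ℕ) :
    (∏ i ∈ Icc 1 p, gammaSer (x i)) * ∏ j ∈ Icc 1 (p + 1), invGammaSer (y j)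
      = triSum (coeffG x y (p + 1)) fun k => invGammaSer (psi x y (p + 1) + k) := by
  induction p with
  | zero =>
    rw [triSum_eq_sum (N := 0) (fun k hk => by simp [coeffG, hk.ne'])]
    simp [coeffG, psi]
  | succ p ih =>
    rw [prod_Icc_succ_top (by omega : 1 ≤ p + 1), prod_Icc_succ_top (by omega : 1 ≤ p + 1 + 1)]
    have : ∀ A B D E : ℂ⟦X⟧, A * B * (D * E) = A * D * (B * E) := fun _ _ _ _ => by ring
    rw [this, ih, triSum_mul]
    rw [triSum_comp _ (fun m k => poch (y (p + 2) - x (p + 1)) k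
        * poch (psi x y (p + 1) + m - x (p + 1)) k / (k.factorial : ℂ))
      (fun k => invGammaSer (psi x y (p + 2) + k))]
    · congr 1
      funext n
      rw [coeffG_succ]
      refine sum_congr rfl fun m _ => ?_
      rw [nu_eq_psi_sub, add_sub_right_comm]
      ring
    · intro m
      rw [mul_comm, gammaSer_gauss]
      congr 1
      funext k
      rw [psi_succ]
      push_cast
      congr 1
      ring

/-! ### The expansion of powers of `1 / z` -/

/-- The series `(e^t - 1) / t - 1`. -/
def expDivSubOne : ℂ⟦X⟧ :=
  PowerSeries.mk fun k : ℕ => if k = 0 then (0 : ℂ) else 1 / ((k + 1).factorial : ℂ)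

lemma constantCoeff_expDivSubOne : constantCoeff expDivSubOne = 0 := by
  rw [← coeff_zero_eq_constantCoeff_apply, expDivSubOne, coeff_mk, if_pos rfl]

lemma X_mul_one_add_expDivSubOne : X * (1 + expDivSubOne) = exp ℂ - 1 := by
  ext n
  cases n with
  | zero => simp
  | succ n =>
    rw [coeff_succ_X_mul, map_add, map_sub, expDivSubOne, coeff_mk, coeff_exp, coeff_one,
      coeff_one, if_neg n.succ_ne_zero]
    rcases eq_or_ne n 0 with rfl | h
    · simp
    · simp [h]

lemma bernoulliNorlund_eq (σ : ℂ) (k : ℕ) (z : ℂ) :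
    bernoulliNorlund σ k z = (k.factorial : ℂ) * coeff k
      ((PowerSeries.binomialSeries ℂ (-σ)).subst expDivSubOne * rescale z (exp ℂ)) := rfl

lemma isPoly_choose (d : ℕ) : IsPoly fun a => Ring.choose a d := by
  have e : (fun a : ℂ => Ring.choose a d)
      = fun a => Polynomial.aeval a (descPochhammer ℤ d) / (d.factorial : ℂ) := by
    funext a
    have h := Ring.descPochhammer_eq_factorial_smul_choose a d
    rw [← Polynomial.aeval_eq_smeval] at h
    rw [eq_div_iff (factorial_cast_ne_zero d), h]
    simp [mul_comm]
  rw [e]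
  exact IsPoly.div_const ⟨(descPochhammer ℤ d).map (algebraMap ℤ ℂ), fun a =>
    (Polynomial.eval_map_algebraMap _ _).symm⟩ _

lemma isPoly_bernoulliNorlund (k : ℕ) (z : ℂ) : IsPoly fun σ => bernoulliNorlund σ k z := by
  simp only [bernoulliNorlund_eq, coeff_mul, coeff_subst_eq_sum constantCoeff_expDivSubOne,
    binomialSeries_coeff]
  refine (IsPoly.const _).mul (IsPoly.sum _ fun ij _ => IsPoly.mul (IsPoly.sum _ fun d _ => ?_)
    (IsPoly.const _))
  refine IsPoly.mul ?_ (IsPoly.const _)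
  simpa using (isPoly_choose d).comp IsPoly.id.neg

/-- For `σ = -j` the binomial series is the polynomial `((e^t - 1) / t)^j`; clearing `t^j` shifts
the coefficient by `j`. -/
lemma bernoulliNorlund_neg_nat (j k : ℕ) (z : ℂ) :
    bernoulliNorlund (-j) k z
      = (k.factorial : ℂ) * coeff (k + j) ((exp ℂ - 1) ^ j * rescale z (exp ℂ)) := by
  have hs : HasSubst expDivSubOne := HasSubst.of_constantCoeff_zero' constantCoeff_expDivSubOne
  rw [bernoulliNorlund_eq, neg_neg, binomialSeries_nat, subst_pow hs, subst_add hs, subst_X hs,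
    ← coe_substAlgHom hs, map_one, ← X_mul_one_add_expDivSubOne, mul_pow, mul_assoc,
    coeff_X_pow_mul]

lemma rise_inv (z u : ℂ) (hz : z ≠ 0) (n : ℕ) :
    rise z⁻¹ (1 + u * z⁻¹) n * z ^ n = rise 1 (z + u) n := by
  induction n with
  | zero => simp
  | succ n ih =>
    rw [rise_succ, rise_succ, ← ih, pow_succ]
    field_simp

lemma poch_eq_descFactorial (M j : ℕ) : poch (M + 1 - j) j = (M.descFactorial j : ℂ) := by
  have h := poch_reflect (-(M : ℂ)) j
  have e : 1 - -(M : ℂ) - j = M + 1 - j := by ring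
  rw [e] at h
  rw [h]
  rcases le_or_gt j M with hj | hj
  · have h1 := poch_neg_mul_factorial hj
    have h2 := Nat.factorial_mul_descFactorial hj
    have h3 : ((M - j).factorial : ℂ) * (M.descFactorial j : ℂ) = (M.factorial : ℂ) := by
      exact_mod_cast h2
    refine mul_right_cancel₀ (factorial_cast_ne_zero (M - j)) ?_
    have hs : ((-1 : ℂ) ^ j) * (-1) ^ j = 1 := by rw [← mul_pow]; simp
    linear_combination (-1) ^ j * h1 + (M.factorial : ℂ) * hs - h3
  · rw [poch_neg_of_lt hj, Nat.descFactorial_of_lt hj]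
    simp

/-- Newton's expansion of `z ^ N`, at the nodes `1 - α + M`. -/
lemma sum_stirling_eq_pow (α : ℂ) (N M : ℕ) :
    ∑ j ∈ range (N + 1), (N.factorial : ℂ) / (j.factorial : ℂ)
        * coeff N ((exp ℂ - 1) ^ j * rescale (1 - α) (exp ℂ)) * (M.descFactorial j : ℂ)
      = ((M : ℂ) + (1 - α)) ^ N := by
  have h1 : (exp ℂ) ^ M * rescale (1 - α) (exp ℂ) = rescale ((M : ℂ) + (1 - α)) (exp ℂ) := by
    rw [exp_pow_eq_rescale_exp, exp_mul_exp_eq_exp_add]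
  have h2 : (exp ℂ) ^ M = ∑ j ∈ range (M + 1), (exp ℂ - 1) ^ j * (M.choose j : ℂ⟦X⟧) := by
    conv_lhs => rw [show exp ℂ = (exp ℂ - 1) + 1 by ring, add_pow]
    simp
  have h3 : coeff N ((exp ℂ) ^ M * rescale (1 - α) (exp ℂ))
      = ∑ j ∈ range (M + 1),
        (M.choose j : ℂ) * coeff N ((exp ℂ - 1) ^ j * rescale (1 - α) (exp ℂ)) := by
    rw [h2, sum_mul, map_sum]
    refine sum_congr rfl fun j _ => ?_
    rw [← coeff_C_mul, map_natCast]
    congr 1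
    ring
  have h0 : constantCoeff (exp ℂ - 1) = 0 := by simp
  -- The binomial expansion stops at `M` and the wanted sum at `N`. Both equal the sum up to `N +
  -- M`: `(e^t - 1)^j` has order at least `j`, and `M.choose j` vanishes for `j > M`.
  have h4 : ∀ A, N ≤ A → M ≤ A → ∑ j ∈ range (A + 1),
        (M.choose j : ℂ) * coeff N ((exp ℂ - 1) ^ j * rescale (1 - α) (exp ℂ))
      = ∑ j ∈ range (N + 1),
        (M.choose j : ℂ) * coeff N ((exp ℂ - 1) ^ j * rescale (1 - α) (exp ℂ)) := by
    intro A hA _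
    refine (sum_subset (range_mono (by omega)) fun j _ hj => ?_).symm
    have hj' : N < j := by simpa using hj
    rw [coeff_mul, sum_eq_zero, mul_zero]
    intro ij hij
    have : ij.1 + ij.2 = N := by simpa using hij
    rw [coeff_pow_eq_zero h0 (by omega), zero_mul]
  have h5 : ∑ j ∈ range (N + M + 1),
        (M.choose j : ℂ) * coeff N ((exp ℂ - 1) ^ j * rescale (1 - α) (exp ℂ))
      = ∑ j ∈ range (M + 1),
        (M.choose j : ℂ) * coeff N ((exp ℂ - 1) ^ j * rescale (1 - α) (exp ℂ)) := by
    refine (sum_subset (range_mono (by omega)) fun j _ hj => ?_).symm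
    have hj' : M < j := by simpa using hj
    rw [Nat.choose_eq_zero_of_lt hj']
    simp
  have h6 : coeff N (rescale ((M : ℂ) + (1 - α)) (exp ℂ))
      = ((M : ℂ) + (1 - α)) ^ N / (N.factorial : ℂ) := by
    rw [coeff_rescale, coeff_exp]
    simp [div_eq_mul_inv]
  have h7 : ((M : ℂ) + (1 - α)) ^ N = (N.factorial : ℂ) * ∑ j ∈ range (N + 1),
        (M.choose j : ℂ) * coeff N ((exp ℂ - 1) ^ j * rescale (1 - α) (exp ℂ)) := by
    rw [← h4 (N + M) (by omega) (by omega), h5, ← h3, h1, h6,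
      mul_div_cancel₀ _ (factorial_cast_ne_zero N)]
  rw [h7, mul_sum]
  refine sum_congr rfl fun j _ => ?_
  have : (M.descFactorial j : ℂ) = (j.factorial : ℂ) * (M.choose j : ℂ) := by
    exact_mod_cast Nat.descFactorial_eq_factorial_mul_choose M j
  rw [this]
  have := factorial_cast_ne_zero j
  field_simp

/-- The coefficients in the inverse factorial expansion of a power of `1 / z`. -/
def powCoeff (α s : ℂ) (k : ℕ) : ℂ :=
  poch (1 - s - k) k / (k.factorial : ℂ) * bernoulliNorlund (s + k) k (1 - α)

lemma powCoeff_neg_nat_of_lt (α : ℂ) {N k : ℕ} (h : N < k) : powCoeff α (-N) k = 0 := by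
  rw [powCoeff, poch_reflect, poch_neg_of_lt h]
  simp

lemma powCoeff_neg_nat (α : ℂ) {N k : ℕ} (h : k ≤ N) :
    powCoeff α (-N) k = (N.factorial : ℂ) / ((N - k).factorial : ℂ)
      * coeff N ((exp ℂ - 1) ^ (N - k) * rescale (1 - α) (exp ℂ)) := by
  have e : -(N : ℂ) + k = -((N - k : ℕ) : ℂ) := by rw [Nat.cast_sub h]; ring
  have h1 := poch_neg_mul_factorial h
  have hs : ((-1 : ℂ) ^ k) * (-1) ^ k = 1 := by rw [← mul_pow]; simp
  have h2 : (-1) ^ k * poch (-(N : ℂ)) k = (N.factorial : ℂ) / ((N - k).factorial : ℂ) := by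
    rw [eq_div_iff (factorial_cast_ne_zero _)]
    linear_combination (-1) ^ k * h1 + (N.factorial : ℂ) * hs
  rw [powCoeff, poch_reflect, e, bernoulliNorlund_neg_nat, Nat.add_sub_cancel' h, h2]
  have := factorial_cast_ne_zero k
  field_simp

/-- The homogeneous form of Newton's expansion of `z ^ N`. -/
lemma sum_powCoeff_neg_nat (α : ℂ) (N : ℕ) :
    ∑ k ∈ range (N + 1), C (powCoeff α (-N) k) * X ^ k
      * rise X (1 + C (α + -N + k) * X) (N - k) = (1 : ℂ⟦X⟧) := by
  set P : Polynomial ℂ := ∑ k ∈ range (N + 1), Polynomial.C (powCoeff α (-N) k) * Polynomial.X ^ k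
      * rise Polynomial.X (1 + Polynomial.C (α + -N + k) * Polynomial.X) (N - k) with hP
  have hrise : ∀ (u : ℂ) n, ((rise Polynomial.X (1 + Polynomial.C u * Polynomial.X) n :
      Polynomial ℂ) : ℂ⟦X⟧) = rise X (1 + C u * X) n := by
    intro u n
    induction n with
    | zero => simp
    | succ n ih =>
      simp only [rise_succ, Polynomial.coe_mul, ih, Polynomial.coe_add, Polynomial.coe_one,
        Polynomial.coe_C, Polynomial.coe_X]
      rw [← Polynomial.coeToPowerSeries.ringHom_apply, map_natCast]
  have hrise2 : ∀ (u w : ℂ) n, (rise Polynomial.X (1 + Polynomial.C u * Polynomial.X) n).eval w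
      = rise w (1 + u * w) n := by
    intro u w n
    induction n with
    | zero => simp
    | succ n ih => simp [rise_succ, ih]
  have hP1 : P = 1 := by
    have hinj : Function.Injective fun M : ℕ => ((M : ℂ) + (1 - α))⁻¹ := by
      intro a b hab
      simpa using hab
    -- The polynomial identity is tested at `X = 1 / z` with `z = M + 1 - α`. The point `0` is
    -- discarded, being the conventional value of the inverse when `z = 0`.
    refine Polynomial.eq_of_infinite_eval_eq _ _
      (((Set.infinite_range_of_injective hinj).sdiff (Set.finite_singleton 0)).mono ?_)
    rintro _ ⟨⟨M, rfl⟩, hM⟩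
    have hz : (M : ℂ) + (1 - α) ≠ 0 := by simpa using hM
    set z := (M : ℂ) + (1 - α) with hzdef
    change Polynomial.eval z⁻¹ P = Polynomial.eval z⁻¹ 1
    rw [Polynomial.eval_one]
    refine mul_right_cancel₀ (pow_ne_zero N hz) ?_
    rw [one_mul]
    refine Eq.trans ?_ (sum_stirling_eq_pow α N M)
    rw [hP, Polynomial.eval_finsetSum, sum_mul, ← sum_range_reflect]
    refine sum_congr rfl fun j hj => ?_
    have hj' : j ≤ N := Nat.lt_succ_iff.mp (mem_range.mp hj)
    have e1 : N + 1 - 1 - j = N - j := by omega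
    have e2 : N - (N - j) = j := by omega
    rw [e1, powCoeff_neg_nat α (by omega : N - j ≤ N), e2]
    have e3 : α + -(N : ℂ) + ((N - j : ℕ) : ℂ) = α - j := by rw [Nat.cast_sub hj']; ring
    have e4 : z + (α - j) = M + 1 - j := by rw [hzdef]; ring
    have e5 := rise_inv z (α - j) hz j
    rw [e4, ← poch_eq_rise, poch_eq_descFactorial] at e5
    rw [e3]
    simp only [Polynomial.eval_mul, Polynomial.eval_C, Polynomial.eval_pow, Polynomial.eval_X,
      hrise2]
    rw [← e5]
    have e6 : z ^ N = z ^ (N - j) * z ^ j := by rw [← pow_add, Nat.sub_add_cancel hj']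
    have e7 : z⁻¹ ^ (N - j) * z ^ (N - j) = 1 := by rw [← mul_pow, inv_mul_cancel₀ hz, one_pow]
    rw [e6]
    linear_combination (N.factorial : ℂ) / (j.factorial : ℂ)
      * coeff N ((exp ℂ - 1) ^ j * rescale (1 - α) (exp ℂ)) * rise z⁻¹ (1 + (α - j) * z⁻¹) j
      * z ^ j * e7
  have := congrArg (fun Q : Polynomial ℂ => (Q : ℂ⟦X⟧)) hP1
  simp only [Polynomial.coe_one] at this
  refine Eq.trans ?_ this
  rw [hP, ← Polynomial.coeToPowerSeries.ringHom_apply, map_sum]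
  refine sum_congr rfl fun k _ => ?_
  rw [Polynomial.coeToPowerSeries.ringHom_apply, Polynomial.coe_mul, hrise]
  simp

/-- The formal inverse factorial expansion of a power of `1 / z`. -/
lemma invGammaSer_eq_triSum (α s : ℂ) :
    invGammaSer α = triSum (powCoeff α s) fun k => invGammaSer (α + s + k) := by
  ext n
  refine IsPoly.eq_of_neg_nat (f := fun _ => coeff n (invGammaSer α)) (g := fun s => coeff n
    (triSum (powCoeff α s) fun k => invGammaSer (α + s + k))) (IsPoly.const _) ?_ ?_ s
  · simp only [coeff_triSum]
    refine IsPoly.sum _ fun k _ => IsPoly.mul (IsPoly.mul (IsPoly.div_const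
      ((isPoly_poch k).comp (((IsPoly.const 1).sub IsPoly.id).sub (IsPoly.const _))) _)
      ((isPoly_bernoulliNorlund k _).comp (IsPoly.id.add (IsPoly.const _))))
      ((isPoly_coeff_invGammaSer _).comp (((IsPoly.const α).add IsPoly.id).add (IsPoly.const _)))
  · intro N
    congr 1
    rw [triSum_eq_sum (N := N) fun k hk => powCoeff_neg_nat_of_lt α hk,
      ← one_mul (invGammaSer α), ← sum_powCoeff_neg_nat α N, sum_mul]
    refine sum_congr rfl fun k hk => ?_
    have hk' : k ≤ N := Nat.lt_succ_iff.mp (mem_range.mp hk)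
    have e2 : α + -(N : ℂ) + k + (N - k : ℕ) = α := by rw [Nat.cast_sub hk']; ring
    rw [invGammaSer_eq (α + -N + k) (N - k), e2]
    ring

/-- The exponential of the sequence `q̂` is the formal series of the gamma ratio. -/
lemma bellY_qHat (p : ℕ) (x y : ℕ → ℂ) (α : ℂ) (r : ℕ) :
    bellY r (qHat (p + 1) x y α) = (r.factorial : ℂ) * coeff r
      (gammaSer α * ((∏ i ∈ Icc 1 p, gammaSer (x i)) * ∏ j ∈ Icc 1 (p + 1), invGammaSer (y j))) := by
  have e : (PowerSeries.mk fun m : ℕ => if m = 0 then (0 : ℂ)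
        else qHat (p + 1) x y α m / (m.factorial : ℂ))
      = stirling α + (∑ i ∈ Icc 1 p, stirling (x i) + ∑ j ∈ Icc 1 (p + 1), -stirling (y j)) := by
    ext m
    simp only [coeff_mk, map_add, map_sum, map_neg, stirling]
    rcases eq_or_ne m 0 with rfl | hm
    · simp
    · simp only [hm, if_false, qHat, q, Nat.add_sub_cancel, sum_neg_distrib, ← mul_sum]
      have hf : (m.factorial : ℂ) = m * ((m - 1).factorial : ℂ) := by
        exact_mod_cast (Nat.mul_factorial_pred hm).symm
      have h1 := factorial_cast_ne_zero (m - 1)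
      have h2 : (m : ℂ) ≠ 0 := by exact_mod_cast hm
      have h3 : (m : ℂ) + 1 ≠ 0 := Nat.cast_add_one_ne_zero m
      rw [hf]
      field_simp
      ring
  have c0 := constantCoeff_stirling
  rw [bellY, e]
  change _ * coeff r (expOf _) = _
  rw [expOf_add (c0 α) (by simp [c0]), expOf_add (by simp [c0]) (by simp [c0]),
    expOf_sum _ (fun i => c0 (x i)), expOf_sum _ (fun j => by simp [c0])]
  rfl

/-- Nørlund's coefficients as a single sum over Bell and Bernoulli–Nørlund polynomials. -/
theorem coeffG_eq_bellSum (p : ℕ) (x y : ℕ → ℂ) (α : ℂ) (n : ℕ) :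
    coeffG x y (p + 1) n = bellSum (p + 1) x y α n := by
  set ν := psi x y (p + 1) with hν
  set Q := gammaSer α * ((∏ i ∈ Icc 1 p, gammaSer (x i)) * ∏ j ∈ Icc 1 (p + 1), invGammaSer (y j))
    with hQ
  have h1 : Q * invGammaSer α = triSum (coeffG x y (p + 1)) fun k => invGammaSer (ν + k) := by
    rw [← prod_gammaSer_eq, hQ]
    linear_combination ((∏ i ∈ Icc 1 p, gammaSer (x i)) * ∏ j ∈ Icc 1 (p + 1), invGammaSer (y j))
      * gammaSer_mul_invGammaSer α
  -- Each `X^r invGammaSer α` is expanded with `s = ν - α + r`, the exponent for which all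
  -- expansions run along the same series `invGammaSer (ν + k)`.
  have h2 : Q * invGammaSer α = triSum (fun n => ∑ r ∈ range (n + 1), coeff r Q
      * powCoeff α (ν - α + r) (n - r)) fun k => invGammaSer (ν + k) := by
    rw [triSum_const]
    refine triSum_comp _ (fun r k => powCoeff α (ν - α + r) k) _ _ fun r => ?_
    rw [invGammaSer_eq_triSum α (ν - α + r)]
    congr 1
    funext k
    congr 1
    push_cast
    ring
  have h3 := triSum_injective (fun k => constantCoeff_invGammaSer _) (h1.symm.trans h2)
  rw [h3, bellSum, ← hν]
  refine sum_congr rfl fun r hr => ?_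
  have hr' : r ≤ n := Nat.lt_succ_iff.mp (mem_range.mp hr)
  have e1 : 1 - (ν - α + r) - ((n - r : ℕ) : ℂ) = 1 + α - ν - n := by
    rw [Nat.cast_sub hr']; ring
  have e2 : ν - α + r + ((n - r : ℕ) : ℂ) = n + ν - α := by
    rw [Nat.cast_sub hr']; ring
  rw [bellY_qHat, ← hQ, powCoeff, e1, e2]
  have := factorial_cast_ne_zero r
  field_simp

end Formal

/-! ### Convergence and uniqueness of the inverse gamma series -/

section Analytic

open Filter Topology

/-! ### Estimates for rising factorials -/

lemma rise_nonneg {A : ℝ} (hA : 0 ≤ A) (k : ℕ) : 0 ≤ rise 1 A k :=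
  prod_nonneg fun i _ => by positivity

lemma rise_pos {A : ℝ} (hA : 0 < A) (k : ℕ) : 0 < rise 1 A k :=
  prod_pos fun i _ => by positivity

lemma rise_le_rise {A B : ℝ} (hA : 0 ≤ A) (hAB : A ≤ B) (k : ℕ) : rise 1 A k ≤ rise 1 B k :=
  prod_le_prod (fun i _ => by positivity) fun i _ => by linarith

lemma norm_poch_le (a : ℂ) (k : ℕ) : ‖poch a k‖ ≤ rise 1 ‖a‖ k := by
  rw [poch_eq_rise, rise, rise, norm_prod]
  refine prod_le_prod (fun i _ => norm_nonneg _) fun i _ => ?_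
  refine (norm_add_le _ _).trans ?_
  simp

lemma rise_re_le_norm_poch {c : ℂ} (hc : 0 ≤ c.re) (k : ℕ) : rise 1 c.re k ≤ ‖poch c k‖ := by
  rw [poch_eq_rise, rise, rise, norm_prod]
  refine prod_le_prod (fun i _ => by positivity) fun i _ => ?_
  refine le_trans (le_of_eq ?_) (Complex.re_le_norm _)
  simp

lemma poch_ofReal (A : ℝ) (k : ℕ) : poch (A : ℂ) k = ((rise 1 A k : ℝ) : ℂ) := by
  rw [poch_eq_rise, rise, rise]
  push_cast
  rfl

lemma poch_ne_zero {c : ℂ} (hc : 0 < c.re) (k : ℕ) : poch c k ≠ 0 :=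
  norm_pos_iff.mp ((rise_pos hc k).trans_le (rise_re_le_norm_poch hc.le k))

lemma Gamma_add_nat {c : ℂ} (hc : 0 < c.re) (k : ℕ) :
    Complex.Gamma (c + k) = Complex.Gamma c * poch c k := by
  induction k with
  | zero => simp
  | succ k ih =>
    have hk : c + k ≠ 0 := by
      intro h
      have := congrArg Complex.re h
      simp at this
      linarith [(Nat.cast_nonneg k : (0 : ℝ) ≤ k)]
    rw [Nat.cast_succ, ← add_assoc, Complex.Gamma_add_one _ hk, ih, poch_succ]
    ring

lemma realGamma_add_nat {R : ℝ} (hR : 0 < R) (k : ℕ) :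
    Real.Gamma (R + k) = Real.Gamma R * rise 1 R k := by
  have h := Gamma_add_nat (c := (R : ℂ)) (by simpa using hR) k
  rw [poch_ofReal, Complex.Gamma_ofReal] at h
  have e : ((R : ℂ) + k) = ((R + k : ℝ) : ℂ) := by push_cast; rfl
  rw [e, Complex.Gamma_ofReal] at h
  exact_mod_cast h

lemma norm_inv_Gamma_le {c : ℂ} (hc : 0 < c.re) (k : ℕ) :
    ‖(Complex.Gamma (c + k))⁻¹‖
      ≤ Real.Gamma c.re / ‖Complex.Gamma c‖ * (Real.Gamma (c.re + k))⁻¹ := by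
  have h1 : 0 < ‖Complex.Gamma c‖ := norm_pos_iff.mpr (Complex.Gamma_ne_zero_of_re_pos hc)
  have h2 := Real.Gamma_pos_of_pos hc
  have h3 := rise_pos hc k
  rw [Gamma_add_nat hc, realGamma_add_nat hc, norm_inv, norm_mul]
  calc (‖Complex.Gamma c‖ * ‖poch c k‖)⁻¹ ≤ (‖Complex.Gamma c‖ * rise 1 c.re k)⁻¹ := by
        gcongr
        exact rise_re_le_norm_poch hc.le k
    _ = _ := by field_simp

/-! ### Gauss' summation theorem -/

/-- Raabe's test: `k u_k - (k + 1) u_{k+1}` eventually dominates a positive multiple of `u_k`, and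
telescoping bounds the partial sums. -/
lemma summable_gauss_real {A B R : ℝ} (hA : 0 ≤ A) (hB : 0 ≤ B) (hR : A + B < R) :
    Summable fun k : ℕ => rise 1 A k * rise 1 B k / ((k.factorial : ℝ) * rise 1 R k) := by
  have hR0 : 0 < R := by linarith
  set u : ℕ → ℝ := fun k => rise 1 A k * rise 1 B k / ((k.factorial : ℝ) * rise 1 R k) with hu
  have hfac : ∀ k : ℕ, (0 : ℝ) < k.factorial := fun k => by exact_mod_cast k.factorial_pos
  have hu0 : ∀ k, 0 ≤ u k := fun k => by
    have := rise_nonneg hA k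
    have := rise_nonneg hB k
    have := rise_pos hR0 k
    have := hfac k
    simp only [hu]
    positivity
  have hstep : ∀ k : ℕ, (k : ℝ) * u k - (k + 1) * u (k + 1)
      = u k * (((R - A - B) * k - A * B) / (R + k)) := by
    intro k
    have h1 := (rise_pos hR0 k).ne'
    have h2 := (hfac k).ne'
    have h3 : R + k ≠ 0 := by positivity
    have h4 : (k : ℝ) + 1 ≠ 0 := by positivity
    simp only [hu, rise_succ, Nat.factorial_succ]
    push_cast
    rw [mul_one]
    field_simp
    ring
  set δ := R - A - B with hδ
  have hδ0 : 0 < δ := by linarith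
  -- From this `K` on, `(δ k - A B) / (R + k) ≥ δ / 2`.
  obtain ⟨K, hK⟩ := exists_nat_ge ((A * B + δ / 2 * R) / (δ / 2))
  rw [div_le_iff₀ (by positivity)] at hK
  have hle : ∀ k, K ≤ k → δ / 2 * u k ≤ (k : ℝ) * u k - (k + 1) * u (k + 1) := by
    intro k hk
    rw [hstep, mul_comm]
    refine mul_le_mul_of_nonneg_left ?_ (hu0 k)
    rw [le_div_iff₀ (by positivity)]
    have : (K : ℝ) ≤ k := by exact_mod_cast hk
    nlinarith
  have hsum : ∀ n, δ / 2 * ∑ i ∈ range n, u (i + K) + ((n + K : ℕ) : ℝ) * u (n + K)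
      ≤ (K : ℝ) * u K := by
    intro n
    induction n with
    | zero => simp
    | succ n ih =>
      have h := hle (n + K) (by omega)
      rw [sum_range_succ, show n + 1 + K = n + K + 1 by ring]
      push_cast at h ih ⊢
      linarith
  rw [← summable_nat_add_iff K]
  refine summable_of_sum_range_le (c := (K : ℝ) * u K / (δ / 2)) (fun n => hu0 _) fun n => ?_
  rw [le_div_iff₀ (by positivity)]
  have h1 := hsum n
  have h2 : 0 ≤ ((n + K : ℕ) : ℝ) * u (n + K) := mul_nonneg (Nat.cast_nonneg _) (hu0 _)
  linarith

lemma norm_gauss_term_le (a b : ℂ) {R : ℝ} (hR : 0 < R) (k : ℕ) :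
    ‖poch a k * poch b k / (k.factorial : ℂ)‖ / rise 1 R k
      ≤ rise 1 ‖a‖ k * rise 1 ‖b‖ k / ((k.factorial : ℝ) * rise 1 R k) := by
  have h1 := rise_pos hR k
  have h2 : (0 : ℝ) < k.factorial := by exact_mod_cast k.factorial_pos
  rw [norm_div, norm_mul, Complex.norm_natCast, div_div]
  gcongr
  · exact rise_nonneg (norm_nonneg a) k
  · exact norm_poch_le a k
  · exact norm_poch_le b k

lemma summable_gauss_norm {a b : ℂ} {R : ℝ} (hR : ‖a‖ + ‖b‖ < R) :
    Summable fun k : ℕ => ‖poch a k * poch b k / (k.factorial : ℂ)‖ / rise 1 R k := by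
  have hR0 : 0 < R := by linarith [norm_nonneg a, norm_nonneg b]
  refine Summable.of_nonneg_of_le (fun k => ?_) (norm_gauss_term_le a b hR0)
    (summable_gauss_real (norm_nonneg a) (norm_nonneg b) hR)
  exact div_nonneg (norm_nonneg _) (rise_pos hR0 k).le

lemma summable_div_Gamma {t : ℕ → ℂ} {c : ℂ} (hc : 0 < c.re)
    (ht : Summable fun k => ‖t k‖ / rise 1 c.re k) :
    Summable fun k : ℕ => t k / Complex.Gamma (c + k) := by
  refine Summable.of_norm_bounded (ht.mul_left (1 / ‖Complex.Gamma c‖)) fun k => ?_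
  have h1 : 0 < ‖Complex.Gamma c‖ := norm_pos_iff.mpr (Complex.Gamma_ne_zero_of_re_pos hc)
  rw [Gamma_add_nat hc, norm_div, norm_mul, div_mul_div_comm, one_mul]
  have h2 := rise_pos hc k
  gcongr
  exact rise_re_le_norm_poch hc.le k

/-- Dominated convergence: `(c + N)_k` tends to infinity for `k ≥ 1` and is bounded below in norm by
its value for `Re c`, so only the term `k = 0` survives. -/
lemma tendsto_poch_series {t : ℕ → ℂ} {c : ℂ} (hc : 0 < c.re)
    (ht : Summable fun k => ‖t k‖ / rise 1 c.re k) :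
    Tendsto (fun N : ℕ => ∑' k, t k / poch (c + N) k) atTop (𝓝 (t 0)) := by
  have h0 : t 0 = ∑' k, t k * ∏ _i ∈ range k, (0 : ℂ) := by
    rw [tsum_eq_single 0]
    · simp
    · intro k hk
      simp [hk]
  rw [h0]
  refine tendsto_tsum_of_dominated_convergence ht (fun k => ?_) (Eventually.of_forall fun N k => ?_)
  · simp only [div_eq_mul_inv]
    refine Tendsto.const_mul _ ?_
    simp only [poch_eq_rise, rise, ← prod_inv_distrib]
    refine tendsto_finsetProd _ fun i _ => ?_
    refine squeeze_zero_norm' ?_ tendsto_inv_atTop_nhds_zero_nat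
    filter_upwards [eventually_gt_atTop 0] with N hN
    have h1 : (0 : ℝ) < N := by exact_mod_cast hN
    rw [norm_inv]
    refine inv_anti₀ h1 (le_trans ?_ (Complex.re_le_norm _))
    simp only [mul_one, Complex.add_re, Complex.natCast_re]
    linarith [(Nat.cast_nonneg i : (0 : ℝ) ≤ i)]
  · have hN : c.re ≤ (c + N).re := by simp
    have h1 := (rise_le_rise hc.le hN k).trans (rise_re_le_norm_poch (hc.le.trans hN) k)
    have h2 := rise_pos hc k
    rw [norm_div]
    gcongr

/-- The terms of Gauss' series, up to the factor `Γ(c + k)` in the denominator. -/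
def gaussTerm (a b : ℂ) (k : ℕ) : ℂ := poch a k * poch b k / (k.factorial : ℂ)

lemma gaussTerm_succ (a b : ℂ) (k : ℕ) :
    ((k : ℂ) + 1) * gaussTerm a b (k + 1) = (a + k) * (b + k) * gaussTerm a b k := by
  have h1 : (k : ℂ) + 1 ≠ 0 := Nat.cast_add_one_ne_zero k
  have h2 := factorial_cast_ne_zero k
  rw [gaussTerm, gaussTerm, poch_succ, poch_succ, Nat.factorial_succ]
  push_cast
  field_simp

lemma poch_succ_left (a : ℂ) (k : ℕ) : poch a (k + 1) = a * poch (a + 1) k := by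
  rw [add_comm, poch_add]
  simp [poch_succ]

lemma succ_mul_gaussTerm (a b : ℂ) (k : ℕ) :
    ((k : ℂ) + 1) * gaussTerm a b (k + 1) = a * b * gaussTerm (a + 1) (b + 1) k := by
  have h1 : (k : ℂ) + 1 ≠ 0 := Nat.cast_add_one_ne_zero k
  have h2 := factorial_cast_ne_zero k
  rw [gaussTerm, gaussTerm, poch_succ_left, poch_succ_left, Nat.factorial_succ]
  push_cast
  field_simp

lemma summable_gauss {a b c : ℂ} (h : ‖a‖ + ‖b‖ < c.re) :
    Summable fun k : ℕ => gaussTerm a b k / Complex.Gamma (c + k) :=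
  summable_div_Gamma (by linarith [norm_nonneg a, norm_nonneg b]) (summable_gauss_norm h)

/-- The contiguous relation for Gauss' series. -/
lemma gauss_contiguous {a b c : ℂ} (h : ‖a‖ + ‖b‖ + 1 < c.re) :
    (c - a - b) * ∑' k : ℕ, gaussTerm a b k / Complex.Gamma (c + k)
      = (c - a) * (c - b) * ∑' k : ℕ, gaussTerm a b k / Complex.Gamma (c + 1 + k) := by
  have hc : 0 < c.re := by linarith [norm_nonneg a, norm_nonneg b]
  -- The telescoping certificate. It tends to zero because `s (k + 1)` is `a b` times a term of the
  -- convergent Gauss series with all parameters raised by one.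
  set s : ℕ → ℂ := fun k => k * gaussTerm a b k / Complex.Gamma (c + k) with hs
  have hs0 : Tendsto s atTop (𝓝 0) := by
    rw [← tendsto_add_atTop_iff_nat 1]
    have h1 : ‖a + 1‖ + ‖b + 1‖ < (c + 1).re := by
      have e1 := norm_add_le a 1
      have e2 := norm_add_le b 1
      simp only [norm_one, Complex.add_re, Complex.one_re] at e1 e2 ⊢
      linarith
    have h2 := ((summable_gauss h1).mul_left (a * b)).tendsto_atTop_zero
    refine h2.congr fun k => ?_
    simp only [hs]
    push_cast
    rw [succ_mul_gaussTerm, show c + ((k : ℂ) + 1) = c + 1 + k by ring]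
    ring
  have hd : ∀ k, (c - a - b) * (gaussTerm a b k / Complex.Gamma (c + k))
      - (c - a) * (c - b) * (gaussTerm a b k / Complex.Gamma (c + 1 + k)) = s k - s (k + 1) := by
    intro k
    have hk : 0 < (c + k).re := by
      simp only [Complex.add_re, Complex.natCast_re]
      positivity
    have hk0 : c + k ≠ 0 := fun h => by rw [h] at hk; simp at hk
    have hG := Complex.Gamma_ne_zero_of_re_pos hk
    have e1 : Complex.Gamma (c + 1 + k) = (c + k) * Complex.Gamma (c + k) := by
      rw [← Complex.Gamma_add_one _ hk0]
      congr 1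
      ring
    have e2 : Complex.Gamma (c + ((k : ℂ) + 1)) = (c + k) * Complex.Gamma (c + k) := by
      rw [← e1]
      congr 1
      ring
    simp only [hs]
    push_cast
    rw [gaussTerm_succ, e1, e2]
    field_simp
    ring
  have S1 := (summable_gauss (by linarith : ‖a‖ + ‖b‖ < c.re)).hasSum.mul_left (c - a - b)
  have S2 := (summable_gauss (c := c + 1) (by simp; linarith : ‖a‖ + ‖b‖ < (c + 1).re)).hasSum.mul_left
    ((c - a) * (c - b))
  have S3 := (S1.sub S2).tendsto_sum_nat
  have S4 : Tendsto (fun n => ∑ k ∈ range n, ((c - a - b) * (gaussTerm a b k / Complex.Gamma (c + k))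
      - (c - a) * (c - b) * (gaussTerm a b k / Complex.Gamma (c + 1 + k)))) atTop (𝓝 0) := by
    have : ∀ n, ∑ k ∈ range n, ((c - a - b) * (gaussTerm a b k / Complex.Gamma (c + k))
      - (c - a) * (c - b) * (gaussTerm a b k / Complex.Gamma (c + 1 + k))) = - s n := by
      intro n
      simp only [hd]
      rw [sum_range_sub']
      simp [hs]
    simp only [this]
    simpa using hs0.neg
  exact sub_eq_zero.mp (tendsto_nhds_unique S3 S4)

lemma poch_eq_div_GammaSeq {s : ℂ} (hs : 0 < s.re) {n : ℕ} (hn : n ≠ 0) :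
    poch s (n + 1) = (n : ℂ) ^ s * (n.factorial : ℂ) / Complex.GammaSeq s n := by
  have h1 : poch s (n + 1) = ∏ j ∈ range (n + 1), (s + j) := by simp [poch_eq_rise, rise]
  have h2 := poch_ne_zero hs (n + 1)
  have h3 : (n : ℂ) ^ s ≠ 0 := by
    rw [Complex.cpow_ne_zero_iff]; left; exact_mod_cast hn
  have h4 := factorial_cast_ne_zero n
  rw [Complex.GammaSeq, ← h1]
  field_simp

/-- Euler's limit formula for gamma; the powers of `n` cancel since `(c - a) + (c - b) = c + (c - a
- b)`. -/
lemma tendsto_poch_ratio {a b c : ℂ} (h1 : 0 < c.re) (h2 : 0 < (c - a).re) (h3 : 0 < (c - b).re)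
    (h4 : 0 < (c - a - b).re) :
    Tendsto (fun n : ℕ => poch (c - a) (n + 1) * poch (c - b) (n + 1)
        / (poch c (n + 1) * poch (c - a - b) (n + 1))) atTop
      (𝓝 (Complex.Gamma c * Complex.Gamma (c - a - b)
        / (Complex.Gamma (c - a) * Complex.Gamma (c - b)))) := by
  have T := ((Complex.GammaSeq_tendsto_Gamma c).mul
    (Complex.GammaSeq_tendsto_Gamma (c - a - b))).div
    ((Complex.GammaSeq_tendsto_Gamma (c - a)).mul (Complex.GammaSeq_tendsto_Gamma (c - b)))
    (mul_ne_zero (Complex.Gamma_ne_zero_of_re_pos h2) (Complex.Gamma_ne_zero_of_re_pos h3))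
  refine T.congr' ?_
  filter_upwards [eventually_gt_atTop 0] with n hn
  have hn0 : (n : ℂ) ≠ 0 := by exact_mod_cast hn.ne'
  have hp : (n : ℂ) ^ (c - a) * (n : ℂ) ^ (c - b) = (n : ℂ) ^ c * (n : ℂ) ^ (c - a - b) := by
    rw [← Complex.cpow_add _ _ hn0, ← Complex.cpow_add _ _ hn0]
    congr 1
    ring
  have q1 : (n : ℂ) ^ c ≠ 0 := by rw [Complex.cpow_ne_zero_iff]; exact Or.inl hn0
  have q2 : (n : ℂ) ^ (c - a - b) ≠ 0 := by rw [Complex.cpow_ne_zero_iff]; exact Or.inl hn0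
  have q3 := factorial_cast_ne_zero n
  rw [poch_eq_div_GammaSeq h1 hn.ne', poch_eq_div_GammaSeq h2 hn.ne',
    poch_eq_div_GammaSeq h3 hn.ne', poch_eq_div_GammaSeq h4 hn.ne']
  rw [div_mul_div_comm, div_mul_div_comm, div_div_div_eq]
  have e : (n : ℂ) ^ (c - a) * (n.factorial : ℂ) * ((n : ℂ) ^ (c - b) * (n.factorial : ℂ))
      = (n : ℂ) ^ c * (n.factorial : ℂ) * ((n : ℂ) ^ (c - a - b) * (n.factorial : ℂ)) := by
    linear_combination (n.factorial : ℂ) ^ 2 * hp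
  rw [e, mul_comm (Complex.GammaSeq (c - a) n * Complex.GammaSeq (c - b) n),
    mul_div_mul_left _ _ (by simp [q1, q2, q3])]
  simp only [Pi.div_apply]

/-- Gauss' summation theorem. -/
theorem hasSum_gauss {a b c : ℂ} (h : ‖a‖ + ‖b‖ + 1 < c.re) :
    HasSum (fun k : ℕ => gaussTerm a b k / Complex.Gamma (c + k))
      (Complex.Gamma (c - a - b) / (Complex.Gamma (c - a) * Complex.Gamma (c - b))) := by
  have ha := Complex.re_le_norm a
  have hb := Complex.re_le_norm b
  have hna := norm_nonneg a
  have hnb := norm_nonneg b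
  have h1 : 0 < c.re := by linarith
  have h2 : 0 < (c - a).re := by simp only [Complex.sub_re]; linarith
  have h3 : 0 < (c - b).re := by simp only [Complex.sub_re]; linarith
  have h4 : 0 < (c - a - b).re := by simp only [Complex.sub_re]; linarith
  set G : ℂ → ℂ := fun c => ∑' k : ℕ, gaussTerm a b k / Complex.Gamma (c + k) with hG
  -- The quotient of the two sides at `c + N`. The contiguous relation makes it independent of `N`,
  -- and its limit is `1`.
  set F : ℕ → ℂ := fun N => G (c + N) * (Complex.Gamma (c - a + N) * Complex.Gamma (c - b + N))
    / Complex.Gamma (c - a - b + N) with hF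
  have pos : ∀ {d : ℂ}, 0 < d.re → ∀ N : ℕ, 0 < (d + N).re := fun {d} hd N => by
    simp only [Complex.add_re, Complex.natCast_re]
    positivity
  have ne : ∀ {d : ℂ}, 0 < d.re → ∀ N : ℕ, d + N ≠ 0 := fun {d} hd N h => by
    have := pos hd N
    rw [h] at this
    simp at this
  have hstep : ∀ N, F (N + 1) = F N := by
    intro N
    have hN : ‖a‖ + ‖b‖ + 1 < (c + N).re := by
      simp only [Complex.add_re, Complex.natCast_re]
      linarith [(Nat.cast_nonneg N : (0 : ℝ) ≤ N)]
    have hc := gauss_contiguous hN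
    have g4 := Complex.Gamma_ne_zero_of_re_pos (pos h4 N)
    have n4 := ne h4 N
    have ee : c + N - a - b = c - a - b + N := by ring
    simp only [hF, Nat.cast_succ, ← add_assoc]
    rw [Complex.Gamma_add_one _ (ne h2 N), Complex.Gamma_add_one _ (ne h3 N),
      Complex.Gamma_add_one _ n4, div_eq_div_iff (mul_ne_zero n4 g4) g4]
    change (c + N - a - b) * G (c + N) = _ * G (c + N + 1) at hc
    linear_combination -(Complex.Gamma (c - a + N) * Complex.Gamma (c - b + N)
      * Complex.Gamma (c - a - b + N)) * hc
  have hconst : ∀ N, F N = F 0 := fun N => by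
    induction N with
    | zero => rfl
    | succ N ih => rw [hstep, ih]
  have hGlim : Tendsto (fun N : ℕ => G (c + N) * Complex.Gamma (c + N)) atTop (𝓝 1) := by
    have T := tendsto_poch_series (t := gaussTerm a b) h1
      (summable_gauss_norm (by linarith : ‖a‖ + ‖b‖ < c.re))
    have e : gaussTerm a b 0 = 1 := by simp [gaussTerm]
    rw [e] at T
    refine T.congr fun N => ?_
    rw [hG, ← tsum_mul_right]
    refine tsum_congr fun k => ?_
    have := Complex.Gamma_ne_zero_of_re_pos (pos h1 N)
    have := poch_ne_zero (pos h1 N) k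
    rw [Gamma_add_nat (pos h1 N)]
    field_simp
  have hrat := tendsto_poch_ratio h1 h2 h3 h4
  have g1 := Complex.Gamma_ne_zero_of_re_pos h1
  have g2 := Complex.Gamma_ne_zero_of_re_pos h2
  have g3 := Complex.Gamma_ne_zero_of_re_pos h3
  have g4 := Complex.Gamma_ne_zero_of_re_pos h4
  have hlim : Tendsto (fun N : ℕ => F (N + 1)) atTop (𝓝 1) := by
    have T := ((tendsto_add_atTop_iff_nat 1).mpr hGlim).mul (hrat.mul_const
      (Complex.Gamma (c - a) * Complex.Gamma (c - b)
        / (Complex.Gamma c * Complex.Gamma (c - a - b))))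
    rw [show (1 : ℂ) * (Complex.Gamma c * Complex.Gamma (c - a - b)
        / (Complex.Gamma (c - a) * Complex.Gamma (c - b)) *
        (Complex.Gamma (c - a) * Complex.Gamma (c - b)
        / (Complex.Gamma c * Complex.Gamma (c - a - b)))) = 1 by field_simp] at T
    refine T.congr fun N => ?_
    have p1 := poch_ne_zero h1 (N + 1)
    have p4 := poch_ne_zero h4 (N + 1)
    simp only [hF]
    rw [Gamma_add_nat h1, Gamma_add_nat h2, Gamma_add_nat h3, Gamma_add_nat h4]
    field_simp
  have hF0 : F 0 = 1 := by
    refine tendsto_nhds_unique (f := fun N : ℕ => F (N + 1)) (l := atTop) ?_ hlim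
    simp only [hconst]
    exact tendsto_const_nhds
  have hval : G c = Complex.Gamma (c - a - b) / (Complex.Gamma (c - a) * Complex.Gamma (c - b)) := by
    simp only [hF, Nat.cast_zero, add_zero] at hF0
    rw [eq_div_iff (mul_ne_zero g2 g3)]
    rwa [div_eq_iff g4, one_mul] at hF0
  rw [← hval]
  exact (summable_gauss (by linarith)).hasSum

/-! ### The inverse gamma series -/

lemma hasSum_gauss_real {A B R : ℝ} (hA : 0 ≤ A) (hB : 0 ≤ B) (h : A + B + 1 < R) :
    HasSum (fun k : ℕ => rise 1 A k * rise 1 B k / (k.factorial : ℝ) / Real.Gamma (R + k))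
      (Real.Gamma (R - A - B) / (Real.Gamma (R - A) * Real.Gamma (R - B))) := by
  have H := hasSum_gauss (a := (A : ℂ)) (b := (B : ℂ)) (c := (R : ℂ))
    (by simpa [abs_of_nonneg hA, abs_of_nonneg hB] using h)
  rw [← Complex.hasSum_ofReal]
  convert H using 1
  · funext k
    rw [gaussTerm, poch_ofReal, poch_ofReal]
    push_cast [← Complex.Gamma_ofReal]
    rfl
  · push_cast [← Complex.Gamma_ofReal]
    rfl

lemma hasSum_antidiagonal {E : Type*} [NormedAddCommGroup E] [CompleteSpace E] {f : ℕ × ℕ → E}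
    {S : E} (hf : HasSum f S) : HasSum (fun n => ∑ ij ∈ antidiagonal n, f ij) S := by
  have h := (HasAntidiagonal.sigmaAntidiagonalEquivProd (A := ℕ)).hasSum_iff.mpr hf
  refine h.sigma fun n => ?_
  have := hasSum_fintype (fun ij : antidiagonal n => f ij)
  rw [univ_eq_attach, sum_attach (antidiagonal n) f] at this
  exact this

/-- The terms of the double series obtained by expanding each term of an inverse gamma series. -/
def doubleTerm (g : ℕ → ℂ) (a b w : ℂ) (mk : ℕ × ℕ) : ℂ :=
  g mk.1 * (gaussTerm a (b + mk.1) mk.2 / Complex.Gamma (w + mk.1 + mk.2))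

/-- The inner series is summed by Gauss' theorem at `A`, `B + m`, `R + m`. The outer index then
remains only in `Γ(R - A + m)`, so the hypothesis on `g` at `R - A` finishes the proof. -/
lemma summable_double_real {g : ℕ → ℂ} {A B R M : ℝ} (hA : 0 ≤ A) (hB : 0 ≤ B)
    (hg : ∀ R > M, Summable fun m : ℕ => ‖g m‖ / Real.Gamma (R + m))
    (h1 : M + A < R) (h2 : A + B + 1 < R) :
    Summable fun mk : ℕ × ℕ => ‖g mk.1‖ * (rise 1 A mk.2 * rise 1 (B + mk.1) mk.2
      / (mk.2.factorial : ℝ) / Real.Gamma (R + mk.1 + mk.2)) := by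
  have hR0 : 0 < R := by linarith
  have hfib : ∀ m : ℕ, HasSum (fun k : ℕ => ‖g m‖ * (rise 1 A k * rise 1 (B + m) k
      / (k.factorial : ℝ) / Real.Gamma (R + m + k)))
      (‖g m‖ * (Real.Gamma (R + m - A - (B + m)) / (Real.Gamma (R + m - A)
        * Real.Gamma (R + m - (B + m))))) := fun m =>
    (hasSum_gauss_real hA (by positivity) (by linarith)).mul_left _
  rw [summable_prod_of_nonneg]
  · refine ⟨fun m => (hfib m).summable, ?_⟩
    simp only [fun m => (hfib m).tsum_eq]
    refine ((hg (R - A) (by linarith)).mul_left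
      (Real.Gamma (R - A - B) / Real.Gamma (R - B))).congr fun m => ?_
    rw [show R + m - A - (B + m) = R - A - B by ring, show R + m - (B + m) = R - B by ring,
      show R + m - A = R - A + m by ring]
    ring
  · intro mk
    have e1 := rise_nonneg hA mk.2
    have e2 := rise_nonneg (A := B + mk.1) (by positivity) mk.2
    have e3 : 0 < Real.Gamma (R + mk.1 + mk.2) := Real.Gamma_pos_of_pos (by positivity)
    simp only [Pi.zero_apply]
    positivity

lemma norm_gaussTerm_le (a b : ℂ) (m k : ℕ) :
    ‖gaussTerm a (b + m) k‖ ≤ rise 1 ‖a‖ k * rise 1 (‖b‖ + m) k / (k.factorial : ℝ) := by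
  have h1 : ‖b + m‖ ≤ ‖b‖ + m := (norm_add_le _ _).trans (by simp)
  rw [gaussTerm, norm_div, norm_mul, Complex.norm_natCast]
  gcongr
  · exact rise_nonneg (norm_nonneg a) k
  · exact norm_poch_le a k
  · exact (norm_poch_le _ k).trans (rise_le_rise (norm_nonneg _) h1 k)

lemma summable_doubleTerm {g : ℕ → ℂ} {a b w : ℂ} {M : ℝ}
    (hg : ∀ R > M, Summable fun m : ℕ => ‖g m‖ / Real.Gamma (R + m))
    (h1 : M + ‖a‖ < w.re) (h2 : ‖a‖ + ‖b‖ + 1 < w.re) :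
    Summable (doubleTerm g a b w) := by
  have hw : 0 < w.re := by linarith [norm_nonneg a, norm_nonneg b]
  refine Summable.of_norm_bounded ((summable_double_real (norm_nonneg a) (norm_nonneg b) hg h1
    h2).mul_left (Real.Gamma w.re / ‖Complex.Gamma w‖)) fun mk => ?_
  obtain ⟨m, k⟩ := mk
  have e1 := norm_gaussTerm_le a b m k
  have e2 := norm_inv_Gamma_le hw (m + k)
  push_cast at e2
  simp only [doubleTerm, norm_mul, div_eq_mul_inv _ (Complex.Gamma _)]
  rw [add_assoc w, add_assoc w.re]
  calc _ ≤ ‖g m‖ * (rise 1 ‖a‖ k * rise 1 (‖b‖ + m) k / (k.factorial : ℝ)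
        * (Real.Gamma w.re / ‖Complex.Gamma w‖ * (Real.Gamma (w.re + (m + k)))⁻¹)) := by
        gcongr
        exact (norm_nonneg _).trans e1
    _ = _ := by ring

lemma hasSum_doubleTerm_fiber {g : ℕ → ℂ} {a b w : ℂ} (h2 : ‖a‖ + ‖b‖ + 1 < w.re) (m : ℕ) :
    HasSum (fun k => doubleTerm g a b w (m, k))
      (g m / Complex.Gamma (w - a + m) * (Complex.Gamma (w - a - b) / Complex.Gamma (w - b))) := by
  have h : ‖a‖ + ‖b + m‖ + 1 < (w + m).re := by
    have := norm_add_le b m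
    simp only [Complex.norm_natCast, Complex.add_re, Complex.natCast_re] at this ⊢
    linarith
  have H := (hasSum_gauss h).mul_left (g m)
  rw [show w + m - a - (b + m) = w - a - b by ring, show w + m - (b + m) = w - b by ring,
    show w + m - a = w - a + m by ring] at H
  have e : g m / Complex.Gamma (w - a + m) * (Complex.Gamma (w - a - b) / Complex.Gamma (w - b))
      = g m * (Complex.Gamma (w - a - b) / (Complex.Gamma (w - a + m) * Complex.Gamma (w - b))) := by
    ring
  rw [e]
  exact H

lemma sum_antidiagonal_doubleTerm (x y : ℕ → ℂ) (p : ℕ) (w : ℂ) (n : ℕ) :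
    ∑ ij ∈ antidiagonal n,
        doubleTerm (coeffG x y (p + 1)) (y (p + 2) - x (p + 1)) (nu x y (p + 1)) w ij
      = coeffG x y (p + 2) n / Complex.Gamma (w + n) := by
  rw [Nat.sum_antidiagonal_eq_sum_range_succ_mk, coeffG_succ, sum_div]
  refine sum_congr rfl fun m hm => ?_
  have hm' : m ≤ n := Nat.lt_succ_iff.mp (mem_range.mp hm)
  have e : w + m + ((n - m : ℕ) : ℂ) = w + n := by rw [Nat.cast_sub hm']; ring
  simp only [doubleTerm, gaussTerm, e]
  ring

/-- Nørlund's coefficients grow so slowly that the inverse gamma series converges absolutely. -/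
lemma summable_norm_coeffG (x y : ℕ → ℂ) (p : ℕ) :
    ∃ M : ℝ, ∀ R > M, Summable fun m : ℕ => ‖coeffG x y (p + 1) m‖ / Real.Gamma (R + m) := by
  induction p with
  | zero =>
    refine ⟨0, fun R _ => summable_of_ne_finset_zero (s := {0}) fun m hm => ?_⟩
    have : m ≠ 0 := by simpa using hm
    simp [coeffG, this]
  | succ p ih =>
    obtain ⟨M, hM⟩ := ih
    set a := y (p + 2) - x (p + 1) with ha
    set b := nu x y (p + 1) with hb
    refine ⟨max (M + ‖a‖) (‖a‖ + ‖b‖ + 1), fun R hR => ?_⟩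
    have h1 : M + ‖a‖ < R := (le_max_left _ _).trans_lt hR
    have h2 : ‖a‖ + ‖b‖ + 1 < R := (le_max_right _ _).trans_lt hR
    have hR0 : 0 < R := by linarith [norm_nonneg a, norm_nonneg b]
    -- At real `w` the norm of the gamma function is its value, so absolute convergence along
    -- antidiagonals is the claim.
    have S := summable_doubleTerm (g := coeffG x y (p + 1)) (w := (R : ℂ)) hM
      (by simpa using h1) (by simpa using h2)
    have S' := (hasSum_antidiagonal S.hasSum).summable.norm
    refine S'.congr fun n => ?_
    rw [sum_antidiagonal_doubleTerm, norm_div]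
    have e : (R : ℂ) + n = ((R + n : ℝ) : ℂ) := by push_cast; rfl
    rw [e, Complex.Gamma_ofReal, Complex.norm_real, Real.norm_of_nonneg]
    exact (Real.Gamma_pos_of_pos (by positivity)).le

/-- The gamma ratio is the sum of the inverse gamma series with Nørlund's coefficients. -/
theorem isInverseGammaSeries_coeffG (x y : ℕ → ℂ) (p : ℕ) :
    IsInverseGammaSeries (p + 1) x y (coeffG x y (p + 1)) := by
  induction p with
  | zero =>
    refine ⟨0, fun z _ => ?_⟩
    have e : (∏ i ∈ Icc 1 (0 + 1 - 1), Complex.Gamma (z + x i))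
        / ∏ j ∈ Icc 1 (0 + 1), Complex.Gamma (z + y j)
        = coeffG x y (0 + 1) 0 / Complex.Gamma (z + psi x y (0 + 1) + (0 : ℕ)) := by
      simp [coeffG, psi]
    rw [e]
    refine hasSum_single 0 fun m hm => ?_
    simp [coeffG, hm]
  | succ p ih =>
    obtain ⟨M₁, h₁⟩ := ih
    obtain ⟨M₂, h₂⟩ := summable_norm_coeffG x y p
    set a := y (p + 2) - x (p + 1) with ha
    set b := nu x y (p + 1) with hb
    set ψ := psi x y (p + 2) with hψ
    have eψ : ψ = psi x y (p + 1) + a := by rw [hψ, psi_succ, ha]; ring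
    have eb : b = psi x y (p + 1) - x (p + 1) := nu_eq_psi_sub x y p
    refine ⟨max M₁ (max (M₂ + ‖a‖) (‖a‖ + ‖b‖ + 1) - ψ.re), fun z hz => ?_⟩
    have hz1 : M₁ < z.re := (le_max_left _ _).trans_lt hz
    have hz2 : max (M₂ + ‖a‖) (‖a‖ + ‖b‖ + 1) < (z + ψ).re := by
      have := (le_max_right _ _).trans_lt hz
      rw [Complex.add_re]
      linarith
    have S := (summable_doubleTerm (g := coeffG x y (p + 1)) (b := b) h₂
      ((le_max_left _ _).trans_lt hz2) ((le_max_right _ _).trans_lt hz2)).hasSum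
    have F := HasSum.prod_fiberwise S fun m =>
      hasSum_doubleTerm_fiber (g := coeffG x y (p + 1)) ((le_max_right _ _).trans_lt hz2) m
    have H := (h₁ z hz1).mul_right (Complex.Gamma (z + x (p + 1)) / Complex.Gamma (z + y (p + 2)))
    -- At `w = z + ψ` the fiber sums of Gauss' theorem are the terms of the series for `p + 1`,
    -- multiplied by the new ratio `Γ(z + x_{p+1}) / Γ(z + y_{p+2})`.
    have e1 : z + ψ - a = z + psi x y (p + 1) := by rw [eψ]; ring
    have e2 : z + ψ - a - b = z + x (p + 1) := by rw [e1, eb]; ring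
    have e3 : z + ψ - b = z + y (p + 2) := by rw [eψ, eb, ha]; ring
    rw [e1] at e2
    simp only [e1, e2, e3] at F
    have hv := F.unique H
    rw [hv] at S
    have R := hasSum_antidiagonal S
    simp only [ha, hb, sum_antidiagonal_doubleTerm] at R
    rw [div_mul_div_comm] at R
    rw [show p + 1 + 1 - 1 = p + 1 by omega, prod_Icc_succ_top (by omega : 1 ≤ p + 1), prod_Icc_succ_top (by omega : 1 ≤ p + 1 + 1)]
    exact R

/-- If the coefficients before `N` vanish, multiplying the series at `w = s + j` by `Γ(s + N + j)`
and letting `j → ∞` leaves `d N` alone, so `d N = 0`. -/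
lemma eq_zero_of_hasSum_zero {d : ℕ → ℂ} {t : ℝ}
    (h : ∀ w : ℂ, t < w.re → HasSum (fun n : ℕ => d n / Complex.Gamma (w + n)) 0) : d = 0 := by
  funext N
  induction N using Nat.strong_induction_on with
  | _ N ih =>
    obtain ⟨s, hs0, hst⟩ : ∃ s : ℝ, 0 < s ∧ t < s :=
      ⟨max t 0 + 1, by positivity, by linarith [le_max_left t 0]⟩
    have key : ∀ j : ℕ, HasSum (fun k : ℕ => d (k + N) / poch ((s : ℂ) + N + j) k) 0 := by
      intro j
      have h1 := h ((s : ℂ) + j) (by simp; linarith [(Nat.cast_nonneg j : (0 : ℝ) ≤ j)])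
      have hpos : 0 < ((s : ℂ) + N + j).re := by simp; positivity
      have h2 := (hasSum_nat_add_iff' N).mpr h1
      rw [sum_eq_zero (fun i hi => by simp [ih i (mem_range.mp hi)]), sub_zero] at h2
      have h3 := h2.mul_right (Complex.Gamma ((s : ℂ) + N + j))
      rw [zero_mul] at h3
      have e : (fun k : ℕ => d (k + N) / poch ((s : ℂ) + N + j) k) = fun k : ℕ =>
          d (k + N) / Complex.Gamma ((s : ℂ) + j + (k + N : ℕ))
            * Complex.Gamma ((s : ℂ) + N + j) := by
        funext k
        have e1 : (s : ℂ) + j + (k + N : ℕ) = (s : ℂ) + N + j + k := by push_cast; ring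
        have g1 := Complex.Gamma_ne_zero_of_re_pos hpos
        have g2 := poch_ne_zero hpos k
        rw [e1, Gamma_add_nat hpos]
        field_simp
      rw [e]
      exact h3
    have T := tendsto_poch_series (t := fun k => d (k + N)) (c := (s : ℂ) + N)
      (by simp; positivity) (by
        have := (key 0).summable.norm
        refine this.congr fun k => ?_
        have e : (s : ℂ) + N + (0 : ℕ) = ((s + N : ℝ) : ℂ) := by push_cast; ring
        rw [norm_div, e, poch_ofReal, Complex.norm_real, Real.norm_of_nonneg
          (rise_nonneg (by positivity) k)]
        simp)
    simp only [fun j => (key j).tsum_eq, zero_add] at T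
    exact (tendsto_nhds_unique T tendsto_const_nhds)

/-- The coefficients of an inverse gamma series are unique. -/
theorem isInverseGammaSeries_unique {p : ℕ} {x y g g' : ℕ → ℂ}
    (h : IsInverseGammaSeries p x y g) (h' : IsInverseGammaSeries p x y g') : g = g' := by
  obtain ⟨M, hM⟩ := h
  obtain ⟨M', hM'⟩ := h'
  refine sub_eq_zero.mp (eq_zero_of_hasSum_zero (t := max M M' + (psi x y p).re) fun w hw => ?_)
  have hz : max M M' < (w - psi x y p).re := by rw [Complex.sub_re]; linarith
  have H := (hM _ ((le_max_left _ _).trans_lt hz)).sub (hM' _ ((le_max_right _ _).trans_lt hz))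
  rw [sub_self] at H
  simp only [sub_add_cancel, ← sub_div] at H
  exact H

end Analytic

end Norlund

end

theorem mainTheorem2 (p : ℕ) (hp : 1 ≤ p) (x y : ℕ → ℂ) :
    (∀ g : ℕ → ℂ, Norlund.IsInverseGammaSeries p x y g ↔ g = Norlund.coeffG x y p) ∧
    ∀ (α : ℂ) (n : ℕ),
      Norlund.coeffG x y p n = Norlund.bellSum p x y α n ∧
      (3 ≤ p → Norlund.Regular₁ p x y n →
        HasSum (Norlund.term₁ p x y n) (Norlund.bellSum p x y α n)) ∧
      (3 ≤ p → Odd p → Norlund.RegularOdd p x y n →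
        HasSum (Norlund.termOdd p x y n) (Norlund.bellSum p x y α n)) ∧
      (4 ≤ p → Even p → Norlund.RegularEven p x y n →
        HasSum (Norlund.termEven p x y n) (Norlund.bellSum p x y α n)) := by
  obtain ⟨p, rfl⟩ : ∃ k, p = k + 1 := ⟨p - 1, by omega⟩
  have hG := Norlund.isInverseGammaSeries_coeffG x y p
  refine ⟨fun g => ⟨fun hg => Norlund.isInverseGammaSeries_unique hg hG, fun hg => hg ▸ hG⟩,
    fun α n => ?_⟩
  rw [← Norlund.coeffG_eq_bellSum p x y α n]
  exact ⟨rfl, fun h3 hr => Norlund.hasSum_term₁ _ h3 x y n hr,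
    fun h3 ho hr => Norlund.hasSum_termOdd _ h3 ho x y n hr,
    fun h4 he hr => Norlund.hasSum_termEven _ h4 he x y n hr⟩
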